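/- There is a deterministic algorithm with the following property. Given an integer $r\ge 3$ and a finite graph $G$ that has no induced path on four vertices (that is, a cograph), the algorithm computes the maximum number of pairwise vertex-disjoint copies of the star $K_{1,r}$ in $G$ (copies as subgraphs, not necessarily induced), in time bounded by a polynomial in the number $n$ of vertices of $G$. (Time is the number of steps on a random access machine whose arithmetic operations, addition and truncated subtraction of natural numbers, cost one step each; the input is $r$, $n$ and the adjacency matrix of $G$.) -/

import Mathlib

/-! ### A random access machine with a step count

The memory consists of banks (arrays) `x = 0, 1, 2, …`, each holding a natural number in every cell
`i = 0, 1, 2, …`. A program names only finitely many banks, and addresses the cells of a bank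
dynamically. The arithmetic operations are addition and (truncated) subtraction only, so that the
uniform cost used below is polynomially related to the running time on Turing machines. -/

namespace RAM

/-- The contents of the memory: `s x i` is the number in cell `i` of bank `x`. -/
abbrev Memory : Type := ℕ → ℕ → ℕ

/-- Writing the number `v` into cell `i` of bank `x`. -/
def Memory.write (s : Memory) (x i v : ℕ) : Memory :=
  Function.update s x (Function.update (s x) i v)

/-- Arithmetic expressions: constants, reading cell `e` of bank `x`, sums, truncated differences. -/
inductive Exp : Type
  | lit (c : ℕ) : Exp
  | read (x : ℕ) (e : Exp) : Exp
  | add (e f : Exp) : Exp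
  | sub (e f : Exp) : Exp

/-- The value of an expression. -/
def Exp.eval (s : Memory) : Exp → ℕ
  | .lit c => c
  | .read x e => s x (e.eval s)
  | .add e f => e.eval s + f.eval s
  | .sub e f => e.eval s - f.eval s

/-- The number of steps it takes to evaluate an expression: one for every operation in it. -/
def Exp.cost : Exp → ℕ
  | .lit _ => 1
  | .read _ e => e.cost + 1
  | .add e f => e.cost + f.cost + 1
  | .sub e f => e.cost + f.cost + 1

/-- Programs. `assign x e f` writes the value of `f` into cell `e` of bank `x`; the tests in
`cond` and `loop` (a while loop) succeed when the value of the expression is not `0`. -/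
inductive Prog : Type
  | skip : Prog
  | assign (x : ℕ) (e f : Exp) : Prog
  | seq (P Q : Prog) : Prog
  | cond (e : Exp) (P Q : Prog) : Prog
  | loop (e : Exp) (P : Prog) : Prog

/-- `Exec P s s' t`: the program `P`, started with memory `s`, halts after exactly `t` steps with
memory `s'`. -/
inductive Exec : Prog → Memory → Memory → ℕ → Prop
  | skip (s : Memory) : Exec .skip s s 1
  | assign (x : ℕ) (e f : Exp) (s : Memory) :
      Exec (.assign x e f) s (s.write x (e.eval s) (f.eval s)) (e.cost + f.cost + 1)
  | seq {P Q : Prog} {s s' s'' : Memory} {t u : ℕ} :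
      Exec P s s' t → Exec Q s' s'' u → Exec (.seq P Q) s s'' (t + u)
  | cond_true {e : Exp} {P Q : Prog} {s s' : Memory} {t : ℕ} :
      e.eval s ≠ 0 → Exec P s s' t → Exec (.cond e P Q) s s' (e.cost + 1 + t)
  | cond_false {e : Exp} {P Q : Prog} {s s' : Memory} {t : ℕ} :
      e.eval s = 0 → Exec Q s s' t → Exec (.cond e P Q) s s' (e.cost + 1 + t)
  | loop_true {e : Exp} {P : Prog} {s s' s'' : Memory} {t u : ℕ} :
      e.eval s ≠ 0 → Exec P s s' t → Exec (.loop e P) s' s'' u →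
      Exec (.loop e P) s s'' (e.cost + 1 + t + u)
  | loop_false {e : Exp} {P : Prog} {s : Memory} :
      e.eval s = 0 → Exec (.loop e P) s s (e.cost + 1)

open Classical in
/-- The input for a number `r` and a graph `G` on the vertices `0, …, n - 1`: bank `0` holds `r`
and bank `1` holds `n` (both in cell `0`), bank `2` holds the adjacency matrix of `G`, row by row,
with entries `0` and `1`; all other cells are `0`. -/
noncomputable def inputMemory (r : ℕ) {n : ℕ} (G : SimpleGraph (Fin n)) : Memory
  | 0, 0 => r
  | 1, 0 => n
  | 2, k => if ∃ i j : Fin n, G.Adj i j ∧ k = n * (i : ℕ) + (j : ℕ) then 1 else 0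
  | _, _ => 0

/-- The output is the number in cell `0` of bank `3`. -/
def output (s : Memory) : ℕ := s 3 0

end RAM

/-! ### Graphs -/

/-- `G` has no induced path on `d` vertices. -/
def NoInducedPath (d : ℕ) {V : Type*} (G : SimpleGraph V) : Prop :=
  ¬ (SimpleGraph.pathGraph d).IsIndContained G

/-- The star `K_{1,r}` with `r` leaves. -/
abbrev starK (r : ℕ) : SimpleGraph (Fin 1 ⊕ Fin r) := completeBipartiteGraph (Fin 1) (Fin r)

/-- `G` contains `k` pairwise vertex-disjoint copies of `H` (as not necessarily induced
subgraphs). -/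
def HasDisjointCopies {V W : Type*} (H : SimpleGraph W) (G : SimpleGraph V) (k : ℕ) : Prop :=
  ∃ f : Fin k → SimpleGraph.Copy H G,
    ∀ i j : Fin k, i ≠ j → Disjoint (Set.range (f i)) (Set.range (f j))

/-! Call `(a, e)` feasible for a vertex set `X` if `X` contains `a` centres and `e` further
vertices, the leaves, each assigned to an adjacent centre, with at most `r` leaves per centre. If
`k` centres have `k * r` leaves, each has exactly `r`; so `k` disjoint stars exist iff `(k, k * r)`
is feasible for the whole vertex set. Feasibility is downward closed in `e`, so one number per `X`
and `a` records it: one more than the largest feasible `e`, or `0` if there is none.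

If `X` and `Y` are disjoint and completely joined or completely unjoined, the feasible pairs of `X ∪
Y` are determined by those of `X` and `Y` and by the two sizes (`starFeasible_union`). Across a
complete join only the numbers of unused vertices and of free places at centres matter, because
leaves can be handed out greedily.

Without induced four-vertex paths, every set of at least two vertices splits into two such parts
(`PathFourFree.splits`) and hence contains twins (`PathFourFree.exists_twins`). The algorithm starts
from singletons and keeps a partition into pairwise joined or unjoined blocks, each with a
representative. Twins among the representatives give two blocks that may be merged
(`exists_mergeable`, `merge_den`), until at most one block is left (`mergeAll_den`).

All loops run from `0` to `n` and are nested to a fixed depth, so the number of steps is polynomial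
in `n` (`exec_compile`). The value of `r` affects only the numbers stored, not the number of rounds.
-/

/-! ### Twins in graphs without induced paths on four vertices -/

namespace SimpleGraph

/-- `G` has no induced path on four vertices, in elementary terms. -/
def PathFourFree {V : Type*} (G : SimpleGraph V) : Prop :=
  ∀ a b c d, G.Adj a b → G.Adj b c → G.Adj c d →
    ¬ G.Adj a c → ¬ G.Adj b d → ¬ G.Adj a d → False

/-- `S` splits into two nonempty parts which are completely joined or completely unjoined. -/
def Splits {V : Type*} [DecidableEq V] (G : SimpleGraph V) (S : Finset V) : Prop :=
  ∃ A B : Finset V, A.Nonempty ∧ B.Nonempty ∧ Disjoint A B ∧ A ∪ B = S ∧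
    ((∀ a ∈ A, ∀ b ∈ B, G.Adj a b) ∨ (∀ a ∈ A, ∀ b ∈ B, ¬ G.Adj a b))

variable {V : Type*} {G : SimpleGraph V}

/-- The path on four vertices is self-complementary: an induced path `a b c d` of `Gᶜ` is the
induced path `b d a c` of `G`. -/
lemma PathFourFree.compl (h : G.PathFourFree) : Gᶜ.PathFourFree := by
  intro a b c d hab hbc hcd hac hbd had
  have hne : a ≠ c := by rintro rfl; exact had hcd
  have hne' : b ≠ d := by rintro rfl; exact had hab
  have hne'' : a ≠ d := by rintro rfl; exact hac hcd.symm
  rw [compl_adj] at *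
  have h1 : G.Adj a c := by tauto
  have h2 : G.Adj b d := by tauto
  have h3 : G.Adj a d := by tauto
  exact h b d a c h2 h3.symm h1 (fun h => hab.2 h.symm) (fun h => hcd.2 h.symm) hbc.2

lemma PathFourFree.of_noInducedPath (h : NoInducedPath 4 G) : G.PathFourFree := by
  intro a b c d hab hbc hcd hac hbd had
  refine h ⟨⟨⟨![a, b, c, d], ?_⟩, ?_⟩⟩
  · intro i j hij
    have h1 := hab.ne
    have h2 := hbc.ne
    have h3 := hcd.ne
    -- Vertices at distance two or more on the path are distinct because a third vertex is adjacent
    -- to exactly one of them.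
    have h4 : a ≠ c := by rintro rfl; exact had hcd
    have h5 : b ≠ d := by rintro rfl; exact had hab
    have h6 : a ≠ d := by rintro rfl; exact hac hcd.symm
    fin_cases i <;> fin_cases j <;> simp_all
  · intro i j
    change G.Adj (![a, b, c, d] i) (![a, b, c, d] j) ↔ _
    rw [pathGraph_adj]
    fin_cases i <;> fin_cases j <;> simp_all [adj_comm]

variable [DecidableEq V]

lemma Splits.of_compl {S : Finset V} (h : Gᶜ.Splits S) : G.Splits S := by
  obtain ⟨A, B, hA, hB, hd, hS, h⟩ := h
  refine ⟨A, B, hA, hB, hd, hS, ?_⟩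
  have hne : ∀ a ∈ A, ∀ b ∈ B, a ≠ b := fun a ha b hb hab =>
    Finset.disjoint_left.1 hd ha (hab ▸ hb)
  simp only [compl_adj] at h
  rcases h with h | h
  · exact Or.inr fun a ha b hb => (h a ha b hb).2
  · refine Or.inl fun a ha b hb => ?_
    have := h a ha b hb
    have := hne a ha b hb
    tauto

/-- If `v` has a neighbour `b` in `B`, the non-neighbours of `v` in `A` can be cut off: an edge from
such an `a` to a neighbour `y` of `v` in `A` would give the induced path `a y v b`. If `v` has no
neighbour in `B`, it can join the side of `A`. -/
lemma PathFourFree.splits_insert_of_not_adj (h : G.PathFourFree) {A B : Finset V} {v z : V}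
    (hv : v ∉ A ∪ B) (hB : B.Nonempty) (hd : Disjoint A B)
    (hn : ∀ a ∈ A, ∀ b ∈ B, ¬ G.Adj a b) (hz : z ∈ A) (hvz : ¬ G.Adj v z) :
    G.Splits (insert v (A ∪ B)) := by
  classical
  have hAB : ∀ x, x ∈ A → x ∉ B := fun x hx hx' => Finset.disjoint_left.1 hd hx hx'
  simp only [Finset.mem_union, not_or] at hv
  by_cases hvB : ∃ b ∈ B, G.Adj v b
  · obtain ⟨b, hb, hvb⟩ := hvB
    refine ⟨A.filter (fun a => ¬ G.Adj v a), insert v (A.filter (fun a => G.Adj v a) ∪ B),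
      ⟨z, by simp [hz, hvz]⟩, ⟨v, by simp⟩, ?_, ?_, Or.inr ?_⟩
    · rw [Finset.disjoint_left]
      intro x hx hx'
      simp only [Finset.mem_filter, Finset.mem_insert, Finset.mem_union] at hx hx'
      rcases hx' with rfl | hx' | hx'
      · exact hv.1 hx.1
      · exact hx.2 hx'.2
      · exact hAB x hx.1 hx'
    · ext x
      simp only [Finset.mem_filter, Finset.mem_insert, Finset.mem_union]
      tauto
    · intro a ha y hy
      simp only [Finset.mem_filter, Finset.mem_insert, Finset.mem_union] at ha hy
      rcases hy with rfl | hy | hy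
      · exact fun h => ha.2 h.symm
      · intro hay
        exact h a y v b hay hy.2.symm hvb (fun h => ha.2 h.symm) (hn y hy.1 b hb) (hn a ha.1 b hb)
      · exact hn a ha.1 y hy
  · push Not at hvB
    refine ⟨insert v A, B, ⟨v, by simp⟩, hB, ?_, by simp, Or.inr ?_⟩
    · rw [Finset.disjoint_insert_left]; exact ⟨hv.2, hd⟩
    · intro a ha b hb
      rcases Finset.mem_insert.1 ha with rfl | ha
      · exact hvB b hb
      · exact hn a ha b hb

lemma PathFourFree.splits_insert (h : G.PathFourFree) {A B : Finset V} {v : V}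
    (hv : v ∉ A ∪ B) (hA : A.Nonempty) (hB : B.Nonempty) (hd : Disjoint A B)
    (hn : ∀ a ∈ A, ∀ b ∈ B, ¬ G.Adj a b) : G.Splits (insert v (A ∪ B)) := by
  by_cases hall : ∀ z ∈ A ∪ B, G.Adj v z
  · exact ⟨{v}, A ∪ B, by simp, hA.mono Finset.subset_union_left, by simpa using hv, by
      rw [Finset.insert_eq], Or.inl (by simpa using hall)⟩
  · push Not at hall
    obtain ⟨z, hz, hvz⟩ := hall
    rcases Finset.mem_union.1 hz with hz | hz
    · exact h.splits_insert_of_not_adj hv hB hd hn hz hvz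
    · rw [Finset.union_comm] at hv ⊢
      exact h.splits_insert_of_not_adj hv hA hd.symm (fun a ha b hb h => hn b hb a ha h.symm) hz hvz

/-- Vertices are added one at a time. If the parts so far are joined rather than unjoined, the step
is carried out in the complement, which satisfies the same hypothesis. -/
lemma PathFourFree.splits (h : G.PathFourFree) (S : Finset V) (hS : 2 ≤ S.card) :
    G.Splits S := by
  induction S using Finset.induction_on with
  | empty => simp at hS
  | insert v S hv ih =>
    rw [Finset.card_insert_of_notMem hv] at hS
    rcases Nat.lt_or_ge S.card 2 with hlt | hge
    · obtain ⟨u, rfl⟩ := Finset.card_eq_one.1 (by omega : S.card = 1)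
      refine ⟨{v}, {u}, by simp, by simp, by simpa using hv, by rw [Finset.insert_eq], ?_⟩
      simpa using em (G.Adj v u)
    · obtain ⟨A, B, hA, hB, hd, rfl, hj | hn⟩ := ih hge
      · refine Splits.of_compl (h.compl.splits_insert hv hA hB hd fun a ha b hb hab => ?_)
        exact ((compl_adj ..).1 hab).2 (hj a ha b hb)
      · exact h.splits_insert hv hA hB hd hn

/-- Twins inside one part of a splitting remain twins in `S`, since a vertex of the other part is
adjacent to both or to neither. Two singleton parts are twins trivially. -/
lemma PathFourFree.exists_twins (h : G.PathFourFree) (S : Finset V) (hS : 2 ≤ S.card) :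
    ∃ u ∈ S, ∃ v ∈ S, u ≠ v ∧ ∀ w ∈ S, w ≠ u → w ≠ v → (G.Adj u w ↔ G.Adj v w) := by
  induction S using Finset.strongInduction with
  | H S ih =>
    obtain ⟨A, B, hA, hB, hd, rfl, hAB⟩ := h.splits S hS
    have hcard := Finset.card_union_of_disjoint hd
    have hA' := hA.card_pos
    have hB' := hB.card_pos
    rcases Nat.lt_or_ge A.card 2 with hA2 | hA2
    · rcases Nat.lt_or_ge B.card 2 with hB2 | hB2
      · obtain ⟨a, rfl⟩ := Finset.card_eq_one.1 (by omega : A.card = 1)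
        obtain ⟨b, rfl⟩ := Finset.card_eq_one.1 (by omega : B.card = 1)
        refine ⟨a, by simp, b, by simp, by simpa using hd, ?_⟩
        intro w hw hwa hwb
        simp at hw
        tauto
      · obtain ⟨u, hu, v, hv, huv, ht⟩ := ih B (Finset.ssubset_iff_subset_ne.2
          ⟨Finset.subset_union_right, fun h => by rw [← h] at hcard; omega⟩) hB2
        refine ⟨u, Finset.mem_union_right _ hu, v, Finset.mem_union_right _ hv, huv, ?_⟩
        intro w hw hwu hwv
        rcases Finset.mem_union.1 hw with hw | hw
        · rcases hAB with hAB | hAB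
          · simp [(hAB w hw u hu).symm, (hAB w hw v hv).symm]
          · have h1 := hAB w hw u hu
            have h2 := hAB w hw v hv
            rw [adj_comm] at h1 h2
            simp [h1, h2]
        · exact ht w hw hwu hwv
    · obtain ⟨u, hu, v, hv, huv, ht⟩ := ih A (Finset.ssubset_iff_subset_ne.2
          ⟨Finset.subset_union_left, fun h => by rw [← h] at hcard; omega⟩) hA2
      refine ⟨u, Finset.mem_union_left _ hu, v, Finset.mem_union_left _ hv, huv, ?_⟩
      intro w hw hwu hwv
      rcases Finset.mem_union.1 hw with hw | hw
      · exact ht w hw hwu hwv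
      · rcases hAB with hAB | hAB
        · simp [hAB u hu w hw, hAB v hv w hw]
        · simp [hAB u hu w hw, hAB v hv w hw]

/-! ### Partial star packings -/

/-- `φ` assigns to every leaf in `L` an adjacent centre in `C`, at most `r` leaves per centre. -/
structure StarAssign (G : SimpleGraph V) (r : ℕ) (C L : Finset V) (φ : V → V) : Prop where
  disj : Disjoint C L
  maps : ∀ l ∈ L, φ l ∈ C
  adj : ∀ l ∈ L, G.Adj (φ l) l
  cap : ∀ c ∈ C, (L.filter (fun l => φ l = c)).card ≤ r

/-- Inside `X` there are `a` centres with `e` leaves assigned to them, at most `r` for each. -/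
def StarFeasible (G : SimpleGraph V) (r : ℕ) (X : Finset V) (a e : ℕ) : Prop :=
  ∃ (C L : Finset V) (φ : V → V), C ⊆ X ∧ L ⊆ X ∧ G.StarAssign r C L φ ∧ C.card = a ∧ L.card = e

variable {r : ℕ}

lemma StarAssign.mono {C L L' : Finset V} {φ : V → V} (h : G.StarAssign r C L φ) (hL : L' ⊆ L) :
    G.StarAssign r C L' φ where
  disj := h.disj.mono_right hL
  maps l hl := h.maps l (hL hl)
  adj l hl := h.adj l (hL hl)
  cap c hc := (Finset.card_le_card (Finset.filter_subset_filter _ hL)).trans (h.cap c hc)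

lemma StarAssign.card_le {C L : Finset V} {φ : V → V} (h : G.StarAssign r C L φ) :
    L.card ≤ C.card * r := by
  rw [Finset.card_eq_sum_card_fiberwise h.maps]
  simpa using Finset.sum_le_card_nsmul C _ r h.cap

lemma StarAssign.restrict {C L C' L' : Finset V} {φ : V → V} (h : G.StarAssign r C L φ)
    (hC : C' ⊆ C) (hL : L' ⊆ L) (hm : ∀ l ∈ L', φ l ∈ C') : G.StarAssign r C' L' φ where
  disj := h.disj.mono hC hL
  maps := hm
  adj l hl := h.adj l (hL hl)
  cap c hc := (h.mono hL).cap c (hC hc)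

lemma StarAssign.union {C L C' L' : Finset V} {φ ψ : V → V} (h : G.StarAssign r C L φ)
    (h' : G.StarAssign r C' L' ψ) (hC : Disjoint C C') (hL : Disjoint L L') (hCL : Disjoint C L')
    (hLC : Disjoint L C') : ∃ χ, G.StarAssign r (C ∪ C') (L ∪ L') χ := by
  have hl' : ∀ l ∈ L', l ∉ L := fun l hl hl' => Finset.disjoint_left.1 hL hl' hl
  have hc' : ∀ l ∈ C', l ∉ C := fun l hl hl' => Finset.disjoint_left.1 hC hl' hl
  refine ⟨fun l => if l ∈ L then φ l else ψ l, ?_, ?_, ?_, ?_⟩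
  · rw [Finset.disjoint_union_left, Finset.disjoint_union_right, Finset.disjoint_union_right]
    exact ⟨⟨h.disj, hCL⟩, hLC.symm, h'.disj⟩
  · intro l hl
    rcases Finset.mem_union.1 hl with hl | hl
    · simp [hl, h.maps l hl]
    · simp [hl' l hl, h'.maps l hl]
  · intro l hl
    rcases Finset.mem_union.1 hl with hl | hl
    · simp [hl, h.adj l hl]
    · simp [hl' l hl, h'.adj l hl]
  · intro c hc
    rcases Finset.mem_union.1 hc with hc | hc
    · refine (Finset.card_le_card ?_).trans (h.cap c hc)
      intro l hl
      simp only [Finset.mem_filter, Finset.mem_union] at hl ⊢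
      obtain ⟨hl1 | hl1, hl2⟩ := hl
      · simpa [hl1] using hl2
      · simp only [hl' l hl1, if_false] at hl2
        exact absurd hc (hc' c (hl2 ▸ h'.maps l hl1))
    · refine (Finset.card_le_card ?_).trans (h'.cap c hc)
      intro l hl
      simp only [Finset.mem_filter, Finset.mem_union] at hl ⊢
      obtain ⟨hl1 | hl1, hl2⟩ := hl
      · simp only [hl1, if_true] at hl2
        exact absurd (hl2 ▸ h.maps l hl1) (hc' c hc)
      · simpa [hl' l hl1, hl1] using hl2

/-- Greedy: every vertex of `Z` is adjacent to every centre, so only the total capacity `C.card * r`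
can be an obstacle. -/
lemma StarAssign.extend {C L : Finset V} {φ : V → V} (h : G.StarAssign r C L φ) (Z : Finset V)
    (hZC : Disjoint C Z) (hZL : Disjoint L Z) (hadj : ∀ c ∈ C, ∀ z ∈ Z, G.Adj c z)
    (hcard : L.card + Z.card ≤ C.card * r) : ∃ ψ, G.StarAssign r C (L ∪ Z) ψ := by
  induction Z using Finset.induction_on with
  | empty => exact ⟨φ, by simpa using h⟩
  | insert z Z hz ih =>
    rw [Finset.card_insert_of_notMem hz] at hcard
    rw [Finset.disjoint_insert_right] at hZC hZL
    obtain ⟨ψ, hψ⟩ := ih hZC.2 hZL.2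
      (fun c hc y hy => hadj c hc y (Finset.mem_insert_of_mem hy)) (by omega)
    have hcU : (L ∪ Z).card < C.card * r := by
      have := Finset.card_union_le L Z
      omega
    -- Pigeonhole: fewer than `C.card * r` leaves are placed, so some centre has room.
    obtain ⟨c, hc, hlt⟩ : ∃ c ∈ C, ((L ∪ Z).filter (fun l => ψ l = c)).card < r := by
      by_contra hcon
      push Not at hcon
      rw [Finset.card_eq_sum_card_fiberwise hψ.maps] at hcU
      have := Finset.card_nsmul_le_sum C _ r hcon
      simp only [smul_eq_mul] at this
      omega
    have hzU : z ∉ L ∪ Z := by simp [hZL.1, hz]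
    refine ⟨Function.update ψ z c, ?_, ?_, ?_, ?_⟩
    · rw [Finset.union_insert, Finset.disjoint_insert_right]
      exact ⟨hZC.1, hψ.disj⟩
    · intro l hl
      by_cases hlz : l = z
      · simp [hlz, hc]
      · rw [Function.update_of_ne hlz]
        exact hψ.maps l (by simpa [hlz] using hl)
    · intro l hl
      by_cases hlz : l = z
      · subst hlz; simpa using hadj c hc l (by simp)
      · rw [Function.update_of_ne hlz]
        exact hψ.adj l (by simpa [hlz] using hl)
    · intro d hd
      have hsame : (L ∪ Z).filter (fun l => Function.update ψ z c l = d)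
          = (L ∪ Z).filter (fun l => ψ l = d) := by
        refine Finset.filter_congr fun l hl => ?_
        rw [Function.update_of_ne]
        rintro rfl
        exact hzU hl
      rw [Finset.union_insert, Finset.filter_insert, hsame]
      split_ifs with hdc
      · rw [Function.update_self] at hdc
        subst hdc
        exact (Finset.card_insert_le _ _).trans hlt
      · exact hψ.cap d hd

lemma StarFeasible.mono {X : Finset V} {a e e' : ℕ} (h : G.StarFeasible r X a e) (he : e' ≤ e) :
    G.StarFeasible r X a e' := by
  obtain ⟨C, L, φ, hC, hL, hA, ha, rfl⟩ := h
  obtain ⟨L', hL', hc⟩ := Finset.exists_subset_card_eq he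
  exact ⟨C, L', φ, hC, hL'.trans hL, hA.mono hL', ha, hc⟩

lemma StarFeasible.add_le {X : Finset V} {a e : ℕ} (h : G.StarFeasible r X a e) :
    a + e ≤ X.card := by
  obtain ⟨C, L, φ, hC, hL, hA, rfl, rfl⟩ := h
  rw [← Finset.card_union_of_disjoint hA.disj]
  exact Finset.card_le_card (Finset.union_subset hC hL)

lemma starFeasible_singleton (v : V) (a e : ℕ) :
    G.StarFeasible r {v} a e ↔ a ≤ 1 ∧ e = 0 := by
  constructor
  · intro h
    have hle := h.add_le
    obtain ⟨C, L, φ, hC, hL, hA, rfl, rfl⟩ := h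
    have h1 := hA.card_le
    simp only [Finset.card_singleton] at hle
    refine ⟨by omega, ?_⟩
    by_contra h0
    have hC0 : C.card = 0 := by omega
    rw [hC0] at h1
    omega
  · rintro ⟨ha, rfl⟩
    obtain ⟨C, hC, hc⟩ := Finset.exists_subset_card_eq (s := {v}) (n := a) (by simpa using ha)
    exact ⟨C, ∅, id, hC, by simp, ⟨by simp, by simp, by simp, by simp⟩, hc, by simp⟩

/-- `a₁`, `a - a₁` centres and `e₁`, `e₂` assigned leaves inside two sets of sizes `m₁`, `m₂` admit
`x` further leaves of the second set for centres of the first, and `y` the other way around. -/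
def CrossBound (r m₁ m₂ a a₁ e₁ e₂ x y : ℕ) (p : Prop) : Prop :=
  e₁ + x ≤ a₁ * r ∧ e₂ + y ≤ (a - a₁) * r ∧ (a - a₁) + e₂ + x ≤ m₂ ∧ a₁ + e₁ + y ≤ m₁ ∧
    (¬ p → x + y = 0)

/-- From left to right, sort the leaves by their own side and the side of their centre; the four
class sizes satisfy the inequalities. Conversely, choose any `x` unused vertices of `Y` and `y`
unused vertices of `X`, attach them greedily to the centres of the opposite side, and glue the two
assignments. -/
lemma starFeasible_union {X Y : Finset V} (hXY : Disjoint X Y) {p : Prop}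
    (hp : ∀ x ∈ X, ∀ y ∈ Y, (G.Adj x y ↔ p)) (a e : ℕ) :
    G.StarFeasible r (X ∪ Y) a e ↔ ∃ a₁ e₁ e₂ x y, a₁ ≤ a ∧ e = e₁ + e₂ + x + y ∧
      G.StarFeasible r X a₁ e₁ ∧ G.StarFeasible r Y (a - a₁) e₂ ∧
      CrossBound r X.card Y.card a a₁ e₁ e₂ x y p := by
  have hnXY : ∀ v, v ∈ X → v ∉ Y := fun v h h' => Finset.disjoint_left.1 hXY h h'
  constructor
  · rintro ⟨C, L, φ, hC, hL, hA, rfl, rfl⟩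
    have hCX : (C ∩ X).card + (C ∩ Y).card = C.card := by
      rw [← Finset.card_union_of_disjoint
        (hXY.mono Finset.inter_subset_right Finset.inter_subset_right),
        ← Finset.inter_union_distrib_left, Finset.inter_eq_left.2 hC]
    have hA' : C.card - (C ∩ X).card = (C ∩ Y).card := by omega
    have hmem : ∀ l ∈ L, (l ∈ X ∨ l ∈ Y) ∧ (φ l ∈ X ∨ φ l ∈ Y) := fun l hl =>
      ⟨Finset.mem_union.1 (hL hl), Finset.mem_union.1 (hC (hA.maps l hl))⟩
    -- The leaves in `W` whose centre is in `U`.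
    let M (U W : Finset V) : Finset V := L.filter (fun l => φ l ∈ U ∧ l ∈ W)
    have hM : ∀ U W : Finset V, M U W ⊆ L := fun U W => Finset.filter_subset _ _
    have hMW : ∀ U W : Finset V, M U W ⊆ W := fun U W l hl => (Finset.mem_filter.1 hl).2.2
    have hMA : ∀ U : Finset V, ∀ L' ⊆ L, (∀ l ∈ L', φ l ∈ U) →
        G.StarAssign r (C ∩ U) L' φ := fun U L' hL' hU =>
      hA.restrict Finset.inter_subset_left hL' fun l hl =>
        Finset.mem_inter.2 ⟨hA.maps l (hL' hl), hU l hl⟩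
    have hMdW : ∀ U U' W W' : Finset V, Disjoint W W' → Disjoint (M U W) (M U' W') :=
      fun U U' W W' hd => hd.mono (hMW U W) (hMW U' W')
    have hMdU : ∀ U U' W W' : Finset V, Disjoint U U' → Disjoint (M U W) (M U' W') := by
      intro U U' W W' hd
      rw [Finset.disjoint_left]
      intro l hl hl'
      exact Finset.disjoint_left.1 hd (Finset.mem_filter.1 hl).2.1 (Finset.mem_filter.1 hl').2.1
    have hcap : ∀ U : Finset V, (M U X).card + (M U Y).card ≤ (C ∩ U).card * r := by
      intro U
      rw [← Finset.card_union_of_disjoint (hMdW U U X Y hXY)]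
      refine (hMA U _ (Finset.union_subset (hM _ _) (hM _ _)) fun l hl => ?_).card_le
      rcases Finset.mem_union.1 hl with hl | hl
      · exact (Finset.mem_filter.1 hl).2.1
      · exact (Finset.mem_filter.1 hl).2.1
    have hsize : ∀ W : Finset V, (C ∩ W).card + ((M X W).card + (M Y W).card) ≤ W.card := by
      intro W
      rw [← Finset.card_union_of_disjoint (hMdU X Y W W hXY), ← Finset.card_union_of_disjoint]
      · exact Finset.card_le_card (Finset.union_subset Finset.inter_subset_right
          (Finset.union_subset (hMW _ _) (hMW _ _)))
      · exact hA.disj.mono Finset.inter_subset_left (Finset.union_subset (hM _ _) (hM _ _))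
    have hcross : ¬ p → (M X Y).card + (M Y X).card = 0 := by
      intro hnp
      have h1 : M X Y = ∅ := Finset.filter_eq_empty_iff.2 fun l hl h =>
        hnp ((hp _ h.1 _ h.2).1 (hA.adj l hl))
      have h2 : M Y X = ∅ := Finset.filter_eq_empty_iff.2 fun l hl h =>
        hnp ((hp _ h.2 _ h.1).1 (hA.adj l hl).symm)
      simp [h1, h2]
    have hcard : L.card = (M X X).card + (M Y Y).card + (M X Y).card + (M Y X).card := by
      have : L = (M X X ∪ M Y X) ∪ (M X Y ∪ M Y Y) := by
        ext l
        simp only [M, Finset.mem_union, Finset.mem_filter]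
        constructor
        · intro hl
          have := hmem l hl
          tauto
        · tauto
      have hd : Disjoint (M X X ∪ M Y X) (M X Y ∪ M Y Y) := by
        simp only [Finset.disjoint_union_left, Finset.disjoint_union_right]
        exact ⟨⟨hMdW _ _ _ _ hXY, hMdW _ _ _ _ hXY⟩, hMdW _ _ _ _ hXY, hMdW _ _ _ _ hXY⟩
      rw [this, Finset.card_union_of_disjoint hd,
        Finset.card_union_of_disjoint (hMdU _ _ _ _ hXY),
        Finset.card_union_of_disjoint (hMdU _ _ _ _ hXY)]
      omega
    have hX := hsize X
    have hY := hsize Y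
    have hcX := hcap X
    have hcY := hcap Y
    refine ⟨(C ∩ X).card, (M X X).card, (M Y Y).card, (M X Y).card, (M Y X).card,
      by omega, hcard, ⟨C ∩ X, M X X, φ, Finset.inter_subset_right, hMW _ _,
        hMA X _ (hM _ _) fun l hl => (Finset.mem_filter.1 hl).2.1, rfl, rfl⟩,
      ⟨C ∩ Y, M Y Y, φ, Finset.inter_subset_right, hMW _ _,
        hMA Y _ (hM _ _) fun l hl => (Finset.mem_filter.1 hl).2.1, hA'.symm, rfl⟩, ?_⟩
    unfold CrossBound
    rw [hA']
    exact ⟨hcX, by omega, by omega, by omega, hcross⟩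
  · rintro ⟨a₁, e₁, e₂, x, y, ha, rfl, ⟨C, L, φ, hC, hL, hA, rfl, rfl⟩,
      ⟨C', L', ψ, hC', hL', hB, ha', rfl⟩, hx, hy, hsx, hsy, hcross⟩
    rw [← ha'] at hy hsx
    obtain ⟨Z, hZ, rfl⟩ := Finset.exists_subset_card_eq (s := Y \ (C' ∪ L')) (n := x) (by
      rw [Finset.card_sdiff_of_subset (Finset.union_subset hC' hL'),
        Finset.card_union_of_disjoint hB.disj]
      omega)
    obtain ⟨W, hW, rfl⟩ := Finset.exists_subset_card_eq (s := X \ (C ∪ L)) (n := y) (by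
      rw [Finset.card_sdiff_of_subset (Finset.union_subset hC hL),
        Finset.card_union_of_disjoint hA.disj]
      omega)
    rw [Finset.subset_sdiff, Finset.disjoint_union_right] at hZ hW
    obtain ⟨φ', hφ'⟩ := hA.extend Z (hXY.mono hC hZ.1) (hXY.mono hL hZ.1) (by
      intro c hc z hz
      refine (hp c (hC hc) z (hZ.1 hz)).2 (by_contra fun hnp => ?_)
      have := Finset.card_pos.2 ⟨z, hz⟩
      have := hcross hnp
      omega) hx
    obtain ⟨ψ', hψ'⟩ := hB.extend W (hXY.symm.mono hC' hW.1) (hXY.symm.mono hL' hW.1) (by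
      intro c hc z hz
      refine ((hp z (hW.1 hz) c (hC' hc)).2 (by_contra fun hnp => ?_)).symm
      have := Finset.card_pos.2 ⟨z, hz⟩
      have := hcross hnp
      omega) hy
    obtain ⟨χ, hχ⟩ := hφ'.union hψ' (hXY.mono hC hC')
      (by
        simp only [Finset.disjoint_union_left, Finset.disjoint_union_right]
        exact ⟨⟨hXY.mono hL hL', hZ.2.2⟩, hW.2.2.symm, (hXY.mono hW.1 hZ.1).symm⟩)
      (by
        simp only [Finset.disjoint_union_right]
        exact ⟨hXY.mono hC hL', hW.2.1.symm⟩)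
      (by
        simp only [Finset.disjoint_union_left]
        exact ⟨hXY.mono hL hC', hZ.2.1⟩)
    refine ⟨_, _, χ, Finset.union_subset_union hC hC', ?_, hχ, ?_, ?_⟩
    · refine Finset.union_subset (Finset.union_subset ?_ ?_) (Finset.union_subset ?_ ?_)
      · exact hL.trans Finset.subset_union_left
      · exact hZ.1.trans Finset.subset_union_right
      · exact hL'.trans Finset.subset_union_right
      · exact hW.1.trans Finset.subset_union_left
    · rw [Finset.card_union_of_disjoint (hXY.mono hC hC')]
      omega
    · rw [Finset.card_union_of_disjoint, Finset.card_union_of_disjoint (hXY.mono hL hZ.1),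
        Finset.card_union_of_disjoint (hXY.symm.mono hL' hW.1)]
      · omega
      · simp only [Finset.disjoint_union_left, Finset.disjoint_union_right]
        exact ⟨⟨hXY.mono hL hL', hZ.2.2⟩, hW.2.2.symm, (hXY.mono hW.1 hZ.1).symm⟩

/-! ### Graphs on an initial segment of the natural numbers -/

/-- The graph `G` on `0, …, n - 1`, as a graph on `ℕ`. -/
def onNat {n : ℕ} (G : SimpleGraph (Fin n)) : SimpleGraph ℕ where
  Adj x y := ∃ (hx : x < n) (hy : y < n), G.Adj ⟨x, hx⟩ ⟨y, hy⟩
  symm := ⟨fun _ _ ⟨hx, hy, h⟩ => ⟨hy, hx, h.symm⟩⟩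
  loopless := ⟨fun _ ⟨_, _, h⟩ => G.loopless.irrefl _ h⟩

lemma PathFourFree.onNat {n : ℕ} {G : SimpleGraph (Fin n)} (h : G.PathFourFree) :
    G.onNat.PathFourFree := by
  rintro a b c d ⟨ha, hb, hab⟩ ⟨_, hc, hbc⟩ ⟨_, hd, hcd⟩ hac hbd had
  exact h _ _ _ _ hab hbc hcd (fun h => hac ⟨ha, hc, h⟩) (fun h => hbd ⟨hb, hd, h⟩)
    (fun h => had ⟨ha, hd, h⟩)

/-! ### Disjoint stars as feasible pairs -/

lemma StarFeasible.of_hasDisjointCopies {n k : ℕ} {G : SimpleGraph (Fin n)}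
    (h : HasDisjointCopies (starK r) G k) :
    G.onNat.StarFeasible r (Finset.range n) k (k * r) := by
  classical
  obtain ⟨f, hf⟩ := h
  have hsame : ∀ i j p q, f i p = f j q → i = j ∧ p = q := by
    intro i j p q hpq
    have hij : i = j := by
      by_contra hne
      exact Set.disjoint_left.1 (hf i j hne) ⟨p, rfl⟩ ⟨q, hpq.symm⟩
    subst hij
    exact ⟨rfl, (f i).injective hpq⟩
  let c (i : Fin k) : ℕ := (f i (Sum.inl 0) : Fin n)
  let l (ij : Fin k × Fin r) : ℕ := (f ij.1 (Sum.inr ij.2) : Fin n)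
  have hc : Function.Injective c := fun i j hij => (hsame _ _ _ _ (Fin.ext hij)).1
  have hl : Function.Injective l := fun x y hxy => by
    obtain ⟨h1, h2⟩ := hsame _ _ _ _ (Fin.ext hxy)
    exact Prod.ext h1 (Sum.inr_injective h2)
  -- The default `0` is never used, since `φ` is evaluated only at leaves.
  let φ (x : ℕ) : ℕ := if h : ∃ ij, l ij = x then c h.choose.1 else 0
  have hφ : ∀ ij, φ (l ij) = c ij.1 := by
    intro ij
    have h : ∃ ij', l ij' = l ij := ⟨ij, rfl⟩
    have := hl h.choose_spec
    simp only [φ, dif_pos h, this]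
  refine ⟨Finset.univ.image c, Finset.univ.image l, φ, ?_, ?_, ⟨?_, ?_, ?_, ?_⟩, ?_, ?_⟩
  · intro x hx
    obtain ⟨i, -, rfl⟩ := Finset.mem_image.1 hx
    exact Finset.mem_range.2 (Fin.is_lt _)
  · intro x hx
    obtain ⟨i, -, rfl⟩ := Finset.mem_image.1 hx
    exact Finset.mem_range.2 (Fin.is_lt _)
  · rw [Finset.disjoint_left]
    intro x hx hx'
    obtain ⟨i, -, rfl⟩ := Finset.mem_image.1 hx
    obtain ⟨j, -, hj⟩ := Finset.mem_image.1 hx'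
    have := (hsame _ _ _ _ (Fin.ext hj)).2
    simp at this
  · intro x hx
    obtain ⟨ij, -, rfl⟩ := Finset.mem_image.1 hx
    rw [hφ]
    exact Finset.mem_image_of_mem _ (Finset.mem_univ _)
  · intro x hx
    obtain ⟨ij, -, rfl⟩ := Finset.mem_image.1 hx
    rw [hφ]
    exact ⟨Fin.is_lt _, Fin.is_lt _, (f ij.1).toHom.map_adj (by simp)⟩
  · intro x hx
    obtain ⟨i, -, rfl⟩ := Finset.mem_image.1 hx
    have hsub : (Finset.univ.image l).filter (fun x => φ x = c i) ⊆
        (Finset.univ : Finset (Fin r)).image (fun j => l (i, j)) := by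
      intro x hx
      obtain ⟨hx, hx'⟩ := Finset.mem_filter.1 hx
      obtain ⟨ij, -, rfl⟩ := Finset.mem_image.1 hx
      rw [hφ] at hx'
      exact Finset.mem_image.2 ⟨ij.2, Finset.mem_univ _, by rw [← hc hx']⟩
    refine (Finset.card_le_card hsub).trans (Finset.card_image_le.trans ?_)
    simp
  · simp [Finset.card_image_of_injective _ hc]
  · simp [Finset.card_image_of_injective _ hl]

lemma StarFeasible.hasDisjointCopies {n k : ℕ} {G : SimpleGraph (Fin n)}
    (h : G.onNat.StarFeasible r (Finset.range n) k (k * r)) :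
    HasDisjointCopies (starK r) G k := by
  obtain ⟨C, L, φ, hC, hL, hA, hCk, hLk⟩ := h
  -- A centre with fewer than `r` leaves would leave fewer than `k * r` in total.
  have hfib : ∀ c ∈ C, (L.filter (fun l => φ l = c)).card = r := by
    by_contra hcon
    push Not at hcon
    obtain ⟨c, hc, hne⟩ := hcon
    have := Finset.sum_lt_sum hA.cap ⟨c, hc, lt_of_le_of_ne (hA.cap c hc) hne⟩
    rw [← Finset.card_eq_sum_card_fiberwise hA.maps, hLk] at this
    simp [hCk] at this
  let e : Fin k ≃ C := (Finset.equivFinOfCardEq hCk).symm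
  let g (i : Fin k) : Fin r ≃ L.filter (fun l => φ l = (e i : ℕ)) :=
    (Finset.equivFinOfCardEq (hfib _ (e i).2)).symm
  have hg : ∀ i j, (g i j : ℕ) ∈ L ∧ φ (g i j) = e i := fun i j => Finset.mem_filter.1 (g i j).2
  let p (i : Fin k) : Fin 1 ⊕ Fin r → Fin n
    | .inl _ => ⟨e i, Finset.mem_range.1 (hC (e i).2)⟩
    | .inr j => ⟨g i j, Finset.mem_range.1 (hL (hg i j).1)⟩
  have hne : ∀ i i' j, (e i : ℕ) ≠ g i' j := fun i i' j h =>
    Finset.disjoint_left.1 hA.disj (e i).2 (h ▸ (hg i' j).1)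
  have hadj : ∀ i j, G.Adj (p i (.inl 0)) (p i (.inr j)) := by
    intro i j
    obtain ⟨h1, h2, h⟩ := hA.adj _ (hg i j).1
    simp only [(hg i j).2] at h
    exact h
  refine ⟨fun i => ⟨⟨p i, ?_⟩, ?_⟩, ?_⟩
  · rintro (x | x) (y | y) hxy
    · simp at hxy
    · rw [Subsingleton.elim x 0]
      exact hadj i y
    · rw [Subsingleton.elim y 0]
      exact (hadj i x).symm
    · simp at hxy
  · rintro (x | x) (y | y) hxy
    · rw [Subsingleton.elim x y]
    · exact absurd (Fin.val_eq_of_eq hxy) (hne _ _ _)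
    · exact absurd (Fin.val_eq_of_eq hxy).symm (hne _ _ _)
    · have := (g i).injective (Subtype.ext (Fin.val_eq_of_eq hxy))
      rw [this]
  · intro i i' hii'
    rw [Set.disjoint_left]
    rintro _ ⟨x, rfl⟩ ⟨y, hxy⟩
    have hee : (e i : ℕ) ≠ e i' := fun h => hii' (e.injective (Subtype.ext h))
    rcases x with x | x <;> rcases y with y | y
    · exact hee (Fin.val_eq_of_eq hxy).symm
    · exact hne _ _ _ (Fin.val_eq_of_eq hxy).symm
    · exact hne _ _ _ (Fin.val_eq_of_eq hxy)
    · have h : (g i' y : ℕ) = g i x := Fin.val_eq_of_eq hxy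
      exact hee (by rw [← (hg i x).2, ← (hg i' y).2, h])

end SimpleGraph

/-! ### Programs with bounded loops -/

namespace RAM

/-- Programs whose only loops are `forLoop x P`, which runs `P` with cell `0` of bank `x` counting
from `0` to the number in cell `0` of bank `1`. `ifZero e P` runs `P` if `e` is `0`. -/
inductive LoopProg : Type
  | assign (x : ℕ) (e f : Exp) : LoopProg
  | seq (P Q : LoopProg) : LoopProg
  | ifZero (e : Exp) (P : LoopProg) : LoopProg
  | forLoop (x : ℕ) (P : LoopProg) : LoopProg

namespace LoopProg

/-- The memory after `m` rounds of the loop over `x` with the given effect of the body. -/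
def iter (x : ℕ) (body : Memory → Memory) (s : Memory) : ℕ → Memory
  | 0 => s.write x 0 0
  | m + 1 => (body (iter x body s m)).write x 0 (m + 1)

/-- The effect of a program on the memory. -/
def den : LoopProg → Memory → Memory
  | assign x e f, s => s.write x (e.eval s) (f.eval s)
  | seq P Q, s => den Q (den P s)
  | ifZero e P, s => if e.eval s = 0 then den P s else s
  | .forLoop x P, s => iter x (den P) s (s 1 0 + 1)

/-- The banks a program may write to. -/
def writes : LoopProg → List ℕ
  | assign x _ _ => [x]
  | seq P Q => writes P ++ writes Q
  | ifZero _ P => writes P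
  | .forLoop x P => x :: writes P

/-- No loop variable is written to by the body of the loop. -/
def LoopsFixed : LoopProg → Prop
  | assign _ _ _ => True
  | seq P Q => LoopsFixed P ∧ LoopsFixed Q
  | ifZero _ P => LoopsFixed P
  | .forLoop x P => x ∉ writes P ∧ LoopsFixed P

/-- The translation into programs of the random access machine. -/
def compile : LoopProg → Prog
  | assign x e f => .assign x e f
  | seq P Q => .seq (compile P) (compile Q)
  | ifZero e P => .cond e .skip (compile P)
  | .forLoop x P => .seq (.assign x (.lit 0) (.lit 0))
      (.loop (.sub (.add (.read 1 (.lit 0)) (.lit 1)) (.read x (.lit 0)))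
        (.seq (compile P) (.assign x (.lit 0) (.add (.read x (.lit 0)) (.lit 1)))))

open Polynomial in
/-- A bound for the running time, in terms of the number in cell `0` of bank `1`. -/
noncomputable def time : LoopProg → Polynomial ℕ
  | assign _ e f => C (e.cost + f.cost + 1)
  | seq P Q => time P + time Q
  | ifZero e P => C (e.cost + 2) + time P
  | .forLoop _ P => (X + 1) * (time P + 14) + 11

/-! ### Running time and effect of bounded loops -/

lemma _root_.RAM.Memory.write_of_ne (s : Memory) {x y : ℕ} (i v : ℕ) (h : y ≠ x) :
    s.write x i v y = s y := by
  simp [Memory.write, h]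

lemma _root_.RAM.Memory.write_self (s : Memory) (x i v : ℕ) :
    s.write x i v x i = v := by
  simp [Memory.write]

lemma _root_.RAM.Memory.write_apply (s : Memory) (x i v y j : ℕ) :
    s.write x i v y j = if y = x ∧ j = i then v else s y j := by
  unfold Memory.write
  by_cases h : y = x
  · subst h; simp [Function.update_apply]
  · simp [h]

lemma den_of_notMem (P : LoopProg) (s : Memory) {y : ℕ} (hy : y ∉ P.writes) :
    P.den s y = s y := by
  induction P generalizing s with
  | assign x e f =>
    simp only [writes, List.mem_singleton] at hy
    exact s.write_of_ne _ _ hy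
  | seq P Q ihP ihQ =>
    simp only [writes, List.mem_append, not_or] at hy
    rw [den, ihQ _ hy.2, ihP _ hy.1]
  | ifZero e P ih =>
    rw [den]
    split_ifs
    · exact ih _ hy
    · rfl
  | forLoop x P ih =>
    simp only [writes, List.mem_cons, not_or] at hy
    rw [den]
    generalize s 1 0 + 1 = m
    induction m with
    | zero => exact s.write_of_ne _ _ hy.1
    | succ m ihm => rw [iter, Memory.write_of_ne _ _ _ hy.1, ih _ hy.2, ihm]

lemma iter_self (x : ℕ) (body : Memory → Memory) (s : Memory) (m : ℕ) :
    iter x body s m x 0 = m := by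
  cases m <;> simp [iter, Memory.write_self]

lemma iter_of_notMem {P : LoopProg} {x y : ℕ} (hx : y ≠ x) (hy : y ∉ P.writes) (s : Memory)
    (m : ℕ) : iter x P.den s m y = s y := by
  induction m with
  | zero => exact s.write_of_ne _ _ hx
  | succ m ihm => rw [iter, Memory.write_of_ne _ _ _ hx, den_of_notMem _ _ hy, ihm]

/-- The body changes neither bank `1` nor the loop variable, so the test, the truncated difference
of `n + 1` and the counter, first vanishes after exactly `n + 1` rounds. -/
theorem exec_compile (P : LoopProg) (hP : P.LoopsFixed) (h1 : 1 ∉ P.writes) (s : Memory) :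
    ∃ t, Exec P.compile s (P.den s) t ∧ t ≤ P.time.eval (s 1 0) := by
  induction P generalizing s with
  | assign x e f => exact ⟨_, .assign x e f s, by simp [time]⟩
  | seq P Q ihP ihQ =>
    simp only [writes, List.mem_append, not_or] at h1
    obtain ⟨t, ht, htb⟩ := ihP hP.1 h1.1 s
    obtain ⟨u, hu, hub⟩ := ihQ hP.2 h1.2 (P.den s)
    rw [den_of_notMem _ _ h1.1] at hub
    refine ⟨_, .seq ht hu, ?_⟩
    rw [time, Polynomial.eval_add]
    omega
  | ifZero e P ih =>
    by_cases he : e.eval s = 0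
    · obtain ⟨t, ht, htb⟩ := ih hP h1 s
      refine ⟨e.cost + 1 + t, ?_, ?_⟩
      · rw [den, if_pos he]
        exact .cond_false he ht
      · simp only [time, Polynomial.eval_add, Polynomial.eval_C]
        omega
    · refine ⟨e.cost + 1 + 1, ?_, ?_⟩
      · rw [den, if_neg he]
        exact .cond_true he (.skip s)
      · simp only [time, Polynomial.eval_add, Polynomial.eval_C]
        omega
  | forLoop x P ih =>
    simp only [writes, List.mem_cons, not_or] at h1
    let n := s 1 0
    let e : Exp := .sub (.add (.read 1 (.lit 0)) (.lit 1)) (.read x (.lit 0))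
    let B : Prog := .seq P.compile (.assign x (.lit 0) (.add (.read x (.lit 0)) (.lit 1)))
    have hn : ∀ m, iter x P.den s m 1 0 = n := fun m => by rw [iter_of_notMem h1.1 h1.2]
    have heval : ∀ m, e.eval (iter x P.den s m) = n + 1 - m := fun m => by
      simp only [e, Exp.eval, hn, iter_self]
    -- With `d` rounds to go. The `14` steps of overhead per round are `8` for the test and `6` for
    -- the increment; the final failing test costs `8`, and initialising the counter costs `3` more,
    -- whence the `11` in `time`.
    have key : ∀ d m, m + d = n + 1 → ∃ t,
        Exec (.loop e B) (iter x P.den s m) (iter x P.den s (n + 1)) t ∧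
          t ≤ d * (P.time.eval n + 14) + 8 := by
      intro d
      induction d with
      | zero =>
        intro m hm
        obtain rfl : m = n + 1 := by omega
        exact ⟨_, .loop_false (by rw [heval]; omega), by simp [e, Exp.cost]⟩
      | succ d ihd =>
        intro m hm
        obtain ⟨t, ht, htb⟩ := ih hP.2 h1.2 (iter x P.den s m)
        rw [hn] at htb
        obtain ⟨u, hu, hub⟩ := ihd (m + 1) (by omega)
        have hstep := Exec.assign x (.lit 0) (.add (.read x (.lit 0)) (.lit 1))
          (P.den (iter x P.den s m))
        have hval : (Exp.add (.read x (.lit 0)) (.lit 1)).eval (P.den (iter x P.den s m))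
            = m + 1 := by
          simp only [Exp.eval]
          rw [den_of_notMem _ _ hP.1, iter_self]
        rw [hval] at hstep
        refine ⟨_, .loop_true (by rw [heval]; omega) (.seq ht hstep) hu, ?_⟩
        simp only [e, Exp.cost]
        rw [Nat.succ_mul]
        omega
    obtain ⟨t, ht, htb⟩ := key (n + 1) 0 (by omega)
    refine ⟨_, .seq (.assign x (.lit 0) (.lit 0) s) ht, ?_⟩
    simp only [time, Exp.cost, Polynomial.eval_add, Polynomial.eval_mul, Polynomial.eval_X,
      Polynomial.eval_one, Polynomial.eval_ofNat]
    change _ ≤ (n + 1) * (P.time.eval n + 14) + 11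
    omega

/-- Induction over the rounds of a loop. -/
lemma for_induction {P : LoopProg} {x : ℕ} (h1 : 1 ∉ P.writes) (hx1 : x ≠ 1)
    (I : ℕ → Memory → Prop) (s : Memory) (h0 : I 0 (s.write x 0 0))
    (hs : ∀ i s', I i s' → s' x 0 = i → i ≤ s 1 0 → s' 1 0 = s 1 0 →
      I (i + 1) ((P.den s').write x 0 (i + 1))) :
    I (s 1 0 + 1) ((LoopProg.forLoop x P).den s) := by
  rw [den]
  have key : ∀ m, m ≤ s 1 0 + 1 → I m (iter x P.den s m) := by
    intro m
    induction m with
    | zero => exact fun _ => h0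
    | succ m ih =>
      intro hm
      exact hs m _ (ih (by omega)) (iter_self ..) (by omega)
        (by rw [iter_of_notMem (Ne.symm hx1) h1])
  exact key _ le_rfl

/-- The property `R` of the memory depends only on the banks in `l` and on the cells `0` of the
banks in `l'`. -/
def DependsOn (R : Memory → Prop) (l l' : List ℕ) : Prop :=
  ∀ s s' : Memory, (∀ y ∈ l, s y = s' y) → (∀ y ∈ l', s y 0 = s' y 0) → (R s ↔ R s')

/-- Binding the loop variable by a quantifier removes it from the dependencies. This allows
`for_search` to be applied again to an enclosing loop. -/
lemma DependsOn.exists_write {R : Memory → Prop} {l l' : List ℕ} {x : ℕ}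
    (h : DependsOn R l (x :: l')) (hx : x ∉ l) (h1 : 1 ∈ l) :
    DependsOn (fun s => ∃ i ≤ s 1 0, R (s.write x 0 i)) l l' := by
  intro s s' hl hl'
  have hw : ∀ i, R (s.write x 0 i) ↔ R (s'.write x 0 i) := by
    intro i
    refine h _ _ (fun y hy => ?_) (fun y hy => ?_)
    · have hyx : y ≠ x := by rintro rfl; exact hx hy
      rw [Memory.write_of_ne _ _ _ hyx, Memory.write_of_ne _ _ _ hyx, hl y hy]
    · by_cases hyx : y = x
      · rw [hyx, Memory.write_self, Memory.write_self]
      · rw [Memory.write_of_ne _ _ _ hyx, Memory.write_of_ne _ _ _ hyx]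
        exact hl' y ((List.mem_cons.1 hy).resolve_left hyx)
  simp only [hw, hl 1 h1]

/-- A loop whose body makes `Q` true whenever `R` holds searches for a round in which `R` holds. -/
lemma for_search {P : LoopProg} {x : ℕ} {l l' : List ℕ} {Q R : Memory → Prop}
    (h : ∀ s, Q (P.den s) ↔ Q s ∨ R s) (hR : DependsOn R l (x :: l'))
    (hQ : ∀ s i, Q (s.write x 0 i) ↔ Q s)
    (hl : ∀ y ∈ l, y ≠ x ∧ y ∉ P.writes) (hl' : ∀ y ∈ l', y ∉ P.writes) (s : Memory) :
    Q ((LoopProg.forLoop x P).den s) ↔ Q s ∨ ∃ i ≤ s 1 0, R (s.write x 0 i) := by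
  rw [den]
  have key : ∀ m, Q (iter x P.den s m) ↔ Q s ∨ ∃ i < m, R (s.write x 0 i) := by
    intro m
    induction m with
    | zero => simp [iter, hQ]
    | succ m ih =>
      -- At the start of round `m` the memory agrees with `s.write x 0 m` on everything that `R`
      -- depends on.
      rw [iter, hQ, h, ih, hR (iter x P.den s m) (s.write x 0 m)]
      · simp only [Nat.lt_succ_iff_lt_or_eq, or_and_right, exists_or, exists_eq_left, or_assoc]
      · intro y hy
        rw [iter_of_notMem (hl y hy).1 (hl y hy).2, Memory.write_of_ne _ _ _ (hl y hy).1]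
      · intro y hy
        by_cases hyx : y = x
        · rw [hyx, iter_self, Memory.write_self]
        · rw [iter_of_notMem hyx (hl' y ((List.mem_cons.1 hy).resolve_left hyx)),
            Memory.write_of_ne _ _ _ hyx]
  rw [key]
  simp only [Nat.lt_succ_iff]

/-! ### The program -/

/-- The number in cell `0` of bank `x`. -/
abbrev var (x : ℕ) : Exp := .read x (.lit 0)

/-- The entry of the adjacency matrix for the vertices `e` and `f`. -/
abbrev adjE (e f : Exp) : Exp := .read 2 (.add (.read 4 e) f)

/-- The entry for block `e` and `f` centres in the table of bank `8`. -/
abbrev tableE (e f : Exp) : Exp := .read 8 (.add (.read 5 e) f)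

/-- `0` iff `e ≤ f`. -/
abbrev leE (e f : Exp) : Exp := .sub e f

/-- `0` iff `e` and `f` differ. -/
abbrev neE (e f : Exp) : Exp := .sub (.lit 1) (.add (.sub e f) (.sub f e))

/-- `0` iff `e` is not `0`. -/
abbrev posE (e : Exp) : Exp := .sub (.lit 1) e

/-- `0` iff both `e` and `f` are `0`. -/
abbrev andE (e f : Exp) : Exp := .add e f

/-- `0` iff `e` is not `0` or `f` is `0`. -/
abbrev impE (e f : Exp) : Exp := .sub (posE e) (.sub (posE e) f)

/-- Multiplication tables for `n`, `n + 1` and `r`, in the banks `4`, `5`, `6`. -/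
def tables : LoopProg :=
  .forLoop 21 (.seq (.assign 4 (.add (var 21) (.lit 1)) (.add (.read 4 (var 21)) (var 1)))
    (.seq (.assign 5 (.add (var 21) (.lit 1)) (.add (.read 5 (var 21)) (.add (var 1) (.lit 1))))
      (.assign 6 (.add (var 21) (.lit 1)) (.add (.read 6 (var 21)) (var 0)))))

/-- Every vertex becomes a block of size `1`. -/
def singletons : LoopProg :=
  .forLoop 21 (.ifZero (leE (.add (var 21) (.lit 1)) (var 1))
    (.seq (.assign 7 (var 21) (.lit 1))
      (.seq (.assign 8 (.read 5 (var 21)) (.lit 1))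
        (.assign 8 (.add (.read 5 (var 21)) (.lit 1)) (.lit 1)))))

/-- Does the block of bank `14` distinguish those of the banks `12` and `13`? -/
def distinguishE : Exp :=
  andE (posE (.read 7 (var 14))) (andE (neE (var 14) (var 12)) (andE (neE (var 14) (var 13))
    (.sub (.lit 1) (.add (.sub (adjE (var 12) (var 14)) (adjE (var 13) (var 14)))
      (.sub (adjE (var 13) (var 14)) (adjE (var 12) (var 14)))))))

/-- Sets the flag of bank `10` if some block distinguishes those of the banks `12` and `13`. -/
def distinguish : LoopProg :=
  .seq (.assign 10 (.lit 0) (.lit 0))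
    (.forLoop 14 (.ifZero distinguishE (.assign 10 (.lit 0) (.lit 1))))

/-- Can two partial star packings, with the parameters in the banks `15` to `20`, be combined? -/
def combineE : Exp :=
  andE (leE (var 16) (var 15)) (andE (leE (.add (var 17) (.lit 1)) (tableE (var 12) (var 16)))
    (andE (leE (.add (var 18) (.lit 1)) (tableE (var 13) (.sub (var 15) (var 16))))
    (andE (leE (.add (var 17) (var 19)) (.read 6 (var 16)))
    (andE (leE (.add (var 18) (var 20)) (.read 6 (.sub (var 15) (var 16))))
    (andE (leE (.add (.add (.sub (var 15) (var 16)) (var 18)) (var 19)) (.read 7 (var 13)))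
    (andE (leE (.add (.add (var 16) (var 17)) (var 20)) (.read 7 (var 12)))
      (impE (adjE (var 12) (var 13)) (.add (var 19) (var 20)))))))))

/-- The number of leaves of the combined partial star packing. -/
def totalE : Exp := .add (.add (.add (var 17) (var 18)) (var 19)) (var 20)

/-- Enters the combined partial star packing into the table of bank `9`. -/
def combineStep : LoopProg :=
  .ifZero combineE (.assign 9 (var 15) (.add (.read 9 (var 15))
    (.sub (.add totalE (.lit 1)) (.read 9 (var 15)))))

/-- Combines partial star packings in all possible ways. -/
def combine : LoopProg :=
  .forLoop 15 (.forLoop 16 (.forLoop 17 (.forLoop 18 (.forLoop 19 (.forLoop 20 combineStep)))))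

/-- Clears the table of bank `9`. -/
def clear : LoopProg := .forLoop 15 (.assign 9 (var 15) (.lit 0))

/-- Copies the table of bank `9` into the row of the block of bank `12`. -/
def copyRow : LoopProg :=
  .forLoop 15 (.assign 8 (.add (.read 5 (var 12)) (var 15)) (.read 9 (var 15)))

/-- Merges the block of bank `13` into the one of bank `12`. -/
def merge : LoopProg :=
  .seq clear (.seq combine (.seq copyRow (.seq
    (.assign 7 (var 12) (.add (.read 7 (var 12)) (.read 7 (var 13))))
    (.assign 7 (var 13) (.lit 0)))))

/-- Are the blocks of the banks `12` and `13` different, in this order, and not distinguished? -/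
def mergeableE : Exp :=
  andE (leE (.add (var 12) (.lit 1)) (var 13))
    (andE (posE (.read 7 (var 12))) (andE (posE (.read 7 (var 13))) (var 10)))

/-- Merges the block of bank `13` into the one of bank `12` if no other block distinguishes them. -/
def tryMerge : LoopProg := .seq distinguish (.ifZero mergeableE merge)

/-- Merges blocks as long as possible. -/
def mergeAll : LoopProg := .forLoop 11 (.forLoop 12 (.forLoop 13 tryMerge))

/-- Reads off the answer from the table of block `0`. -/
def answer : LoopProg :=
  .forLoop 22 (.ifZero (leE (.add (.read 6 (var 22)) (.lit 1)) (.read 8 (var 22)))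
    (.assign 3 (.lit 0) (var 22)))

/-- The maximum number of disjoint stars in a graph without induced paths on four vertices. -/
def starPacking : LoopProg := .seq tables (.seq singletons (.seq mergeAll answer))

/-! ### Blocks -/

/-- The block of `u`: all vertices with representative `u`. -/
def block (n : ℕ) (rep : ℕ → ℕ) (u : ℕ) : Finset ℕ := (Finset.range n).filter (fun x => rep x = u)

/-- `rep` chooses a representative from each block of a partition of `0, …, n - 1`, any two blocks
of which are completely joined or completely unjoined. -/
structure IsRep (H : SimpleGraph ℕ) (n : ℕ) (rep : ℕ → ℕ) : Prop where
  le : ∀ x < n, rep x ≤ x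
  idem : ∀ x < n, rep (rep x) = rep x
  adj : ∀ x < n, ∀ y < n, rep x ≠ rep y → (H.Adj x y ↔ H.Adj (rep x) (rep y))

/-- The blocks of `u < v` are distinguished by no other block. -/
def Mergeable (H : SimpleGraph ℕ) (n : ℕ) (rep : ℕ → ℕ) (u v : ℕ) : Prop :=
  u < v ∧ v < n ∧ rep u = u ∧ rep v = v ∧
    ∀ w < n, rep w = w → w ≠ u → w ≠ v → (H.Adj u w ↔ H.Adj v w)

/-- The representatives after merging the block of `v` into the block of `u`. -/
def mergeRep (rep : ℕ → ℕ) (u v x : ℕ) : ℕ := if rep x = v then u else rep x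

/-- The set of representatives. -/
def reps (n : ℕ) (rep : ℕ → ℕ) : Finset ℕ := (Finset.range n).filter (fun x => rep x = x)

variable {H : SimpleGraph ℕ} {n r : ℕ} {rep : ℕ → ℕ} {u v : ℕ}

lemma mem_block {x : ℕ} : x ∈ block n rep u ↔ x < n ∧ rep x = u := by
  simp [block]

/-- The program does not store `rep`; it recognises representatives by their nonzero entry in bank
`7`. -/
lemma card_block_ne_zero (h : IsRep H n rep) : (block n rep u).card ≠ 0 ↔ u < n ∧ rep u = u := by
  rw [Finset.card_ne_zero]
  constructor
  · rintro ⟨x, hx⟩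
    obtain ⟨hxn, rfl⟩ := mem_block.1 hx
    exact ⟨(h.le x hxn).trans_lt hxn, h.idem x hxn⟩
  · exact fun hu => ⟨u, mem_block.2 hu⟩

lemma isRep_id : IsRep H n id := ⟨fun _ _ => le_rfl, fun _ _ => rfl, fun _ _ _ _ _ => Iff.rfl⟩

/-- Since `u` and `v` are twins among the representatives, `u` can speak for the block of `v`
towards all other blocks. Merging into the smaller of the two keeps `rep x ≤ x`. -/
lemma IsRep.mergeRep (h : IsRep H n rep) (hm : Mergeable H n rep u v) :
    IsRep H n (mergeRep rep u v) := by
  obtain ⟨huv, hv, hu', hv', ht⟩ := hm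
  have key : ∀ x < n, ∀ y < n, rep x = v → rep y ≠ v → rep y ≠ u →
      (H.Adj x y ↔ H.Adj u (rep y)) := by
    intro x hx y hy hxv hyv hyu
    rw [h.adj x hx y hy (by rw [hxv]; exact Ne.symm hyv), hxv]
    exact (ht _ ((h.le y hy).trans_lt hy) (h.idem y hy) hyu hyv).symm
  refine ⟨fun x hx => ?_, fun x hx => ?_, fun x hx y hy hxy => ?_⟩
  · unfold LoopProg.mergeRep
    have := h.le x hx
    split_ifs with hxv
    · omega
    · exact this
  · unfold LoopProg.mergeRep
    have := h.idem x hx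
    split_ifs <;> simp_all
  · unfold LoopProg.mergeRep at hxy ⊢
    split_ifs at hxy ⊢ with hxv hyv hyv
    · exact absurd rfl hxy
    · exact key x hx y hy hxv hyv (Ne.symm hxy)
    · rw [H.adj_comm, H.adj_comm (rep x)]
      exact key y hy x hx hyv hxv hxy
    · exact h.adj x hx y hy hxy

lemma block_mergeRep_left :
    block n (mergeRep rep u v) u = block n rep u ∪ block n rep v := by
  ext x
  simp only [Finset.mem_union, mem_block, mergeRep]
  split_ifs with h
  · tauto
  · tauto

lemma block_mergeRep_right (hm : Mergeable H n rep u v) : block n (mergeRep rep u v) v = ∅ := by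
  ext x
  have := hm.1.ne
  simp only [mem_block, mergeRep]
  split_ifs with h <;> simp_all

lemma block_mergeRep_of_ne {w : ℕ} (hu : w ≠ u) (hv : w ≠ v) :
    block n (mergeRep rep u v) w = block n rep w := by
  ext x
  simp only [mem_block, mergeRep]
  split_ifs with h
  · subst h; simp [Ne.symm hu, Ne.symm hv]
  · rfl

lemma disjoint_block (huv : u ≠ v) : Disjoint (block n rep u) (block n rep v) := by
  rw [Finset.disjoint_left]
  intro x hx hx'
  exact huv ((mem_block.1 hx).2.symm.trans (mem_block.1 hx').2)

lemma card_reps_mergeRep_lt (hm : Mergeable H n rep u v) :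
    (reps n (mergeRep rep u v)).card < (reps n rep).card := by
  obtain ⟨huv, hv, hu', hv', -⟩ := hm
  refine Finset.card_lt_card ⟨fun x hx => ?_, fun h => ?_⟩
  · rw [reps, Finset.mem_filter, mergeRep] at hx
    refine Finset.mem_filter.2 ⟨hx.1, ?_⟩
    have := hx.2
    split_ifs at this with hxv
    · rw [← this]; exact hu'
    · exact this
  · have := (Finset.mem_filter.1 (h (Finset.mem_filter.2 ⟨Finset.mem_range.2 hv, hv'⟩))).2
    rw [mergeRep, if_pos hv'] at this
    omega

lemma exists_mergeable (hH : H.PathFourFree) (hc : 2 ≤ (reps n rep).card) :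
    ∃ u v, Mergeable H n rep u v := by
  obtain ⟨u, hu, v, hv, huv, ht⟩ := hH.exists_twins _ hc
  simp only [reps, Finset.mem_filter, Finset.mem_range] at hu hv ht
  rcases Nat.lt_or_gt_of_ne huv with hlt | hlt
  · exact ⟨u, v, hlt, hv.1, hu.2, hv.2, fun w hw hw' => ht w ⟨hw, hw'⟩⟩
  · exact ⟨v, u, hlt, hu.1, hv.2, hu.2, fun w hw hw' h1 h2 => (ht w ⟨hw, hw'⟩ h2 h1).symm⟩

/-- As `rep 0 ≤ 0`, the vertex `0` is always a representative, so a sole block is that of `0`. -/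
lemma rep_eq_zero (h : IsRep H n rep) (hc : (reps n rep).card ≤ 1) {x : ℕ} (hx : x < n) :
    rep x = 0 := by
  have h0 : 0 < n := by omega
  refine Finset.card_le_one.1 hc _ ?_ _ ?_
  · exact Finset.mem_filter.2 ⟨Finset.mem_range.2 ((h.le x hx).trans_lt hx), h.idem x hx⟩
  · exact Finset.mem_filter.2 ⟨Finset.mem_range.2 h0, by simpa using h.le 0 h0⟩

/-! ### Invariants -/

/-- The parts of the memory which do not change after the multiplication tables are computed. -/
structure Env (H : SimpleGraph ℕ) (r n : ℕ) (s : Memory) : Prop where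
  size : s 1 0 = n
  adj : ∀ u < n, ∀ v < n, (s 2 (u * n + v) ≠ 0 ↔ H.Adj u v)
  adj_le : ∀ k, s 2 k ≤ 1
  mul_n : ∀ u ≤ n, s 4 u = u * n
  mul_succ : ∀ u ≤ n, s 5 u = u * (n + 1)
  mul_r : ∀ u ≤ n, s 6 u = u * r

lemma Env.congr {s s' : Memory} (h : Env H r n s) (hs : ∀ y ∈ [1, 2, 4, 5, 6], s' y = s y) :
    Env H r n s' := by
  simp only [List.mem_cons, List.not_mem_nil, or_false, forall_eq_or_imp, forall_eq] at hs
  obtain ⟨h1, h2, h4, h5, h6⟩ := hs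
  obtain ⟨k1, k2, k3, k4, k5, k6⟩ := h
  exact ⟨by rw [h1, k1], by rwa [h2], by rwa [h2], by rwa [h4], by rwa [h5], by rwa [h6]⟩

/-- The banks `7` and `8` describe the blocks of `rep` and their partial star packings. -/
structure Describes (H : SimpleGraph ℕ) (r n : ℕ) (rep : ℕ → ℕ) (s : Memory) : Prop where
  isRep : IsRep H n rep
  size : ∀ u, s 7 u = (block n rep u).card
  table : ∀ u < n, rep u = u → ∀ a ≤ n, ∀ e,
    e < s 8 (u * (n + 1) + a) ↔ H.StarFeasible r (block n rep u) a e

lemma Describes.congr {s s' : Memory} (h : Describes H r n rep s) (h7 : s' 7 = s 7)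
    (h8 : s' 8 = s 8) : Describes H r n rep s' :=
  ⟨h.isRep, by rw [h7]; exact h.size, by rw [h8]; exact h.table⟩

/-- Rows of bank `8` have length `n + 1`, for centre counts `0, …, n`, so distinct rows do not
overlap. -/
lemma row_inj {a b : ℕ} (ha : a ≤ n) (hb : b ≤ n) (h : u * (n + 1) + a = v * (n + 1) + b) :
    u = v ∧ a = b := by
  have h1 : (u * (n + 1) + a) / (n + 1) = u := by
    rw [mul_comm, Nat.mul_add_div (by omega), Nat.div_eq_of_lt (by omega), add_zero]
  have h2 : (v * (n + 1) + b) / (n + 1) = v := by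
    rw [mul_comm, Nat.mul_add_div (by omega), Nat.div_eq_of_lt (by omega), add_zero]
  have huv : u = v := by rw [← h1, ← h2, h]
  subst huv
  exact ⟨rfl, by omega⟩

/-! ### Correctness of the parts -/

lemma clear_den (s : Memory) : ∀ a ≤ s 1 0, clear.den s 9 a = 0 := by
  have := for_induction (P := .assign 9 (var 15) (.lit 0)) (x := 15) (by decide) (by decide)
    (fun i s' => ∀ a < i, s' 9 a = 0) s (by simp) (by
      intro i s' hI hi _ _ a ha
      simp only [den, Exp.eval, hi, Memory.write_apply]
      by_cases h : a = i
      · simp [h]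
      · simp [h, hI a (by omega)])
  exact fun a ha => this a (by omega)

lemma copyRow_den (s : Memory) :
    (∀ a ≤ s 1 0, copyRow.den s 8 (s 5 (s 12 0) + a) = s 9 a) ∧
    ∀ k, (∀ a ≤ s 1 0, k ≠ s 5 (s 12 0) + a) → copyRow.den s 8 k = s 8 k := by
  have := for_induction
    (P := .assign 8 (.add (.read 5 (var 12)) (var 15)) (.read 9 (var 15))) (x := 15)
    (by decide) (by decide)
    (fun i s' => s' 5 = s 5 ∧ s' 12 = s 12 ∧ s' 9 = s 9 ∧
      (∀ a < i, s' 8 (s 5 (s 12 0) + a) = s 9 a) ∧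
      ∀ k, (∀ a < i, k ≠ s 5 (s 12 0) + a) → s' 8 k = s 8 k) s
    (by simp [Memory.write_of_ne]) (by
      rintro i s' ⟨h5, h12, h9, hI, hI'⟩ hi _ _
      simp only [den, Exp.eval, hi, h5, h12, h9]
      refine ⟨by simp [Memory.write_of_ne, h5], by simp [Memory.write_of_ne, h12],
        by simp [Memory.write_of_ne, h9], fun a ha => ?_, fun k hk => ?_⟩
      · simp only [Memory.write_apply]
        by_cases h : a = i
        · simp [h]
        · simp [h, hI a (by omega)]
      · have := hk i (by omega)
        simp only [Memory.write_apply]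
        simp [this, hI' k (fun a ha => hk a (by omega))])
  exact ⟨fun a ha => this.2.2.2.1 a (by omega),
    fun k hk => this.2.2.2.2 k (fun a ha => hk a (by omega))⟩

/-- The parameters in the banks `15` to `20` yield a packing with `a` centres and `c` leaves. -/
def Combines (a c : ℕ) (s : Memory) : Prop :=
  combineE.eval s = 0 ∧ s 15 0 = a ∧ c ≤ totalE.eval s

/-- The value written, `m + ((t + 1) - m)` with truncated subtraction, is the maximum of the old
entry `m` and `t + 1`, where `t` is the new number of leaves. -/
lemma combineStep_den (s : Memory) (a c : ℕ) : c < combineStep.den s 9 a ↔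
    c < s 9 a ∨ Combines a c s := by
  rw [combineStep, den, Combines]
  split_ifs with h
  · simp only [den, Memory.write_apply, Exp.eval, true_and]
    by_cases ha : a = s 15 0
    · subst ha
      simp only [if_true, h, true_and]
      omega
    · simp [ha, Ne.symm ha]
  · simp [h]

/-- For a fixed threshold `c`, maximising an entry becomes a search for parameters that exceed it.
Each of the six loops contributes one bounded quantifier. -/
lemma combine_den (s : Memory) (a c : ℕ) : c < combine.den s 9 a ↔
    c < s 9 a ∨ ∃ a' ≤ s 1 0, ∃ a₁ ≤ s 1 0, ∃ e₁ ≤ s 1 0, ∃ e₂ ≤ s 1 0, ∃ x ≤ s 1 0, ∃ y ≤ s 1 0,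
      Combines a c
        ((((((s.write 15 0 a').write 16 0 a₁).write 17 0 e₁).write 18 0 e₂).write 19 0 x).write
          20 0 y) := by
  have hdep : DependsOn (Combines a c) [1, 2, 4, 5, 6, 7, 8] [20, 19, 18, 17, 16, 15, 12, 13] := by
    intro s s' hl hl'
    simp only [List.mem_cons, List.not_mem_nil, or_false, forall_eq_or_imp, forall_eq] at hl hl'
    obtain ⟨h1, h2, h4, h5, h6, h7, h8⟩ := hl
    obtain ⟨h20, h19, h18, h17, h16, h15, h12, h13⟩ := hl'
    simp only [Combines, combineE, totalE, Exp.eval, h2, h4, h5, h6, h7, h8, h20, h19, h18, h17, h16,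
      h15, h12, h13]
  have hQ : ∀ x : ℕ, x ≠ 9 → ∀ (s : Memory) (i : ℕ), c < s.write x 0 i 9 a ↔ c < s 9 a :=
    fun x hx s i => by rw [Memory.write_of_ne _ _ _ (Ne.symm hx)]
  have d19 := hdep.exists_write (by decide) (by decide)
  have d18 := d19.exists_write (by decide) (by decide)
  have d17 := d18.exists_write (by decide) (by decide)
  have d16 := d17.exists_write (by decide) (by decide)
  have d15 := d16.exists_write (by decide) (by decide)
  have f20 := for_search (Q := fun s => c < s 9 a) (fun s => combineStep_den s a c) hdep
    (hQ 20 (by decide)) (by decide) (by decide)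
  have f19 := for_search (Q := fun s => c < s 9 a) f20 d19
    (hQ 19 (by decide)) (by decide) (by decide)
  have f18 := for_search (Q := fun s => c < s 9 a) f19 d18
    (hQ 18 (by decide)) (by decide) (by decide)
  have f17 := for_search (Q := fun s => c < s 9 a) f18 d17
    (hQ 17 (by decide)) (by decide) (by decide)
  have f16 := for_search (Q := fun s => c < s 9 a) f17 d16
    (hQ 16 (by decide)) (by decide) (by decide)
  have f15 := for_search (Q := fun s => c < s 9 a) f16 d15
    (hQ 15 (by decide)) (by decide) (by decide) s
  have h1 : ∀ (x : ℕ), 1 ≠ x → ∀ (s : Memory) (i : ℕ), s.write x 0 i 1 0 = s 1 0 :=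
    fun x hx s i => by rw [Memory.write_of_ne _ _ _ hx]
  simp only [h1 15 (by decide), h1 16 (by decide), h1 17 (by decide), h1 18 (by decide),
    h1 19 (by decide)] at f15
  rw [combine]
  exact f15

lemma distinguish_den (s : Memory) : distinguish.den s 10 0 ≠ 0 ↔
    ∃ w ≤ s 1 0, distinguishE.eval (s.write 14 0 w) = 0 := by
  have hdep : DependsOn (fun s : Memory => distinguishE.eval s = 0)
      [1, 2, 4, 7] [14, 12, 13] := by
    intro s s' hl hl'
    simp only [List.mem_cons, List.not_mem_nil, or_false, forall_eq_or_imp, forall_eq] at hl hl'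
    obtain ⟨h1, h2, h4, h7⟩ := hl
    obtain ⟨h14, h12, h13⟩ := hl'
    simp only [distinguishE, Exp.eval, h2, h4, h7, h14, h12, h13]
  rw [distinguish, den, for_search (Q := fun s => s 10 0 ≠ 0) (l := [1, 2, 4, 7]) (l' := [12, 13])
    (R := fun s => distinguishE.eval s = 0) ?_ hdep ?_ (by decide) (by decide)]
  · have h := (hdep.exists_write (by decide) (by decide)) s (s.write 10 0 0)
      (by simp [Memory.write_of_ne]) (by simp [Memory.write_of_ne])
    simp only [den, Exp.eval, Memory.write_self] at h ⊢
    rw [← h]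
    simp
  · intro s
    rw [den]
    split_ifs with h
    · simp [h, den, Memory.write_apply, Exp.eval]
    · simp [h]
  · intro s i
    rw [Memory.write_of_ne _ _ _ (by decide)]

/-- Translates the arithmetic test of the program into the conditions of `starFeasible_union`, with
strict comparisons against table entries expressing feasibility. -/
lemma combines_iff {s : Memory} (hs : Env H r n s) (hu : u < n) (hv : v < n) (hsu : s 12 0 = u)
    (hsv : s 13 0 = v) {a' a₁ : ℕ} (ha' : a' ≤ n) (ha₁ : a₁ ≤ n) (e₁ e₂ x y a c : ℕ) :
    Combines a c ((((((s.write 15 0 a').write 16 0 a₁).write 17 0 e₁).write 18 0 e₂).write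
      19 0 x).write 20 0 y) ↔
    a' = a ∧ a₁ ≤ a ∧ c ≤ e₁ + e₂ + x + y ∧ e₁ < s 8 (u * (n + 1) + a₁) ∧
      e₂ < s 8 (v * (n + 1) + (a - a₁)) ∧
      SimpleGraph.CrossBound r (s 7 u) (s 7 v) a a₁ e₁ e₂ x y (H.Adj u v) := by
  have hadj := hs.adj u hu v hv
  have hle := hs.adj_le (u * n + v)
  simp only [Combines, combineE, totalE, Exp.eval, Memory.write_apply, SimpleGraph.CrossBound,
    Nat.reduceEqDiff, false_and, if_false, true_and, if_true, hsu, hsv]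
  rw [hs.mul_succ u hu.le, hs.mul_succ v hv.le, hs.mul_r a₁ ha₁, hs.mul_r (a' - a₁) (by omega),
    hs.mul_n u hu.le]
  simp only [Nat.add_eq_zero_iff, Nat.sub_eq_zero_iff_le, Nat.lt_iff_add_one_le]
  constructor
  · rintro ⟨⟨h1, h2, h3, h4, h5, h6, h7, h8⟩, rfl, hc⟩
    refine ⟨rfl, h1, hc, h2, h3, h4, h5, h6, h7, fun hn => ?_⟩
    rw [← hadj] at hn
    omega
  · rintro ⟨rfl, h1, hc, h2, h3, h4, h5, h6, h7, h8⟩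
    refine ⟨⟨h1, h2, h3, h4, h5, h6, h7, ?_⟩, rfl, hc⟩
    by_cases hn : H.Adj u v
    · rw [← hadj] at hn
      omega
    · have := h8 hn
      omega

lemma merge_den {s : Memory} (hs : Env H r n s) (hd : Describes H r n rep s) (hsu : s 12 0 = u)
    (hsv : s 13 0 = v) (hm : Mergeable H n rep u v) :
    Describes H r n (mergeRep rep u v) (merge.den s) := by
  obtain ⟨huv, hv, hu', hv', -⟩ := id hm
  have hu : u < n := huv.trans hv
  have n1 : s 1 0 = n := hs.size
  obtain ⟨s1, hs1⟩ : ∃ s1, s1 = clear.den s := ⟨_, rfl⟩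
  obtain ⟨s2, hs2⟩ : ∃ s2, s2 = combine.den s1 := ⟨_, rfl⟩
  obtain ⟨s3, hs3⟩ : ∃ s3, s3 = copyRow.den s2 := ⟨_, rfl⟩
  have k1 : ∀ y, y ∉ clear.writes → s1 y = s y := fun y hy => by rw [hs1, den_of_notMem _ _ hy]
  have k2 : ∀ y, y ∉ combine.writes → s2 y = s1 y := fun y hy => by
    rw [hs2, den_of_notMem _ _ hy]
  have k3 : ∀ y, y ∉ copyRow.writes → s3 y = s2 y := fun y hy => by
    rw [hs3, den_of_notMem _ _ hy]
  have e1 : Env H r n s1 := hs.congr fun y hy => k1 y (by revert y; decide)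
  have e2 : Env H r n s2 := e1.congr fun y hy => k2 y (by revert y; decide)
  have h12 : s1 12 0 = u := by rw [k1 _ (by decide), hsu]
  have h13 : s1 13 0 = v := by rw [k1 _ (by decide), hsv]
  have hden : merge.den s = (s3.write 7 u (s3 7 u + s3 7 v)).write 7 v 0 := by
    have h3u : s3 12 0 = u := by rw [k3 _ (by decide), k2 _ (by decide), h12]
    have h3v : s3 13 0 = v := by rw [k3 _ (by decide), k2 _ (by decide), h13]
    rw [merge]
    simp only [den, Exp.eval, ← hs1, ← hs2, ← hs3, h3u, h3v, Memory.write_apply,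
      Nat.reduceEqDiff, false_and, if_false]
  have h7 : s3 7 = s 7 := by rw [k3 _ (by decide), k2 _ (by decide), k1 _ (by decide)]
  have h8 : s2 8 = s 8 := by rw [k2 _ (by decide), k1 _ (by decide)]
  have hbase : s2 5 (s2 12 0) = u * (n + 1) := by
    rw [k2 12 (by decide), h12, e2.mul_succ u hu.le]
  obtain ⟨c1, c2⟩ := copyRow_den s2
  rw [← hs3, hbase, e2.size] at c1 c2
  refine ⟨hd.isRep.mergeRep hm, fun w => ?_, fun w hw hww a ha e => ?_⟩
  · rw [hden]
    simp only [Memory.write_apply, true_and, h7]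
    by_cases hwv : w = v
    · simp [hwv, block_mergeRep_right hm]
    · by_cases hwu : w = u
      · simp only [if_false, hwu, if_true, huv.ne]
        rw [block_mergeRep_left, Finset.card_union_of_disjoint (disjoint_block huv.ne), hd.size,
          hd.size]
      · simp only [hwv, if_false, hwu]
        rw [block_mergeRep_of_ne hwu hwv, hd.size]
  · rw [hden, Memory.write_apply, Memory.write_apply]
    simp only [Nat.reduceEqDiff, false_and, if_false]
    -- The old row of `v` stays in bank `8`, but `v` is no longer a representative, so nothing is
    -- claimed about it.
    have hwv : w ≠ v := by
      rintro rfl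
      rw [mergeRep, if_pos hv'] at hww
      omega
    by_cases hwu : w = u
    · subst hwu
      have hun := SimpleGraph.starFeasible_union (G := H) (r := r)
        (disjoint_block (n := n) (rep := rep) huv.ne) (p := H.Adj w v) (fun x hx y hy => by
          rw [mem_block] at hx hy
          rw [hd.isRep.adj x hx.1 y hy.1 (by rw [hx.2, hy.2]; exact huv.ne), hx.2, hy.2]) a
      rw [block_mergeRep_left, c1 a ha, hs2, combine_den, e1.size, hs1,
        clear_den s a (by omega), ← hs1]
      have hiff : ∀ a' ≤ n, ∀ a₁ ≤ n, ∀ e₁ e₂ x y, _ := fun a' ha' a₁ ha₁ e₁ e₂ x y =>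
        combines_iff e1 hu hv h12 h13 ha' ha₁ e₁ e₂ x y a e
      rw [k1 8 (by decide), k1 7 (by decide), hd.size, hd.size] at hiff
      have t1 := hd.table w hu hu'
      have t2 := hd.table v hv hv'
      constructor
      · rintro (h | ⟨a', ha', a₁, ha₁, e₁, -, e₂, -, x, -, y, -, h⟩)
        · omega
        · rw [hiff a' ha' a₁ ha₁] at h
          obtain ⟨rfl, haa, hle, h1, h2, h3⟩ := h
          rw [t1 _ (by omega)] at h1
          rw [t2 _ (by omega)] at h2
          exact ((hun _).2 ⟨a₁, e₁, e₂, x, y, haa, rfl, h1, h2, h3⟩).mono hle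
      · intro h
        obtain ⟨a₁, e₁, e₂, x, y, haa, rfl, h1, h2, h3⟩ := (hun _).1 h
        -- Blocks have at most `n` vertices, so `CrossBound` places all parameters within the range
        -- of the loops.
        have hX : (block n rep w).card ≤ n :=
          (Finset.card_filter_le _ _).trans (by simp)
        have hY : (block n rep v).card ≤ n :=
          (Finset.card_filter_le _ _).trans (by simp)
        obtain ⟨i1, i2, i3, i4, i5⟩ := id h3
        refine Or.inr ⟨a, ha, a₁, by omega, e₁, by omega, e₂, by omega, x, by omega, y, by omega,
          ?_⟩
        rw [hiff a ha a₁ (by omega), t1 _ (by omega), t2 _ (by omega)]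
        exact ⟨rfl, haa, le_rfl, h1, h2, h3⟩
    -- All other rows are untouched, by `row_inj`.
    · rw [c2, h8, block_mergeRep_of_ne hwu hwv]
      · refine hd.table w hw ?_ a ha e
        rw [mergeRep] at hww
        split_ifs at hww
        · exact absurd hww.symm hwu
        · exact hww
      · intro b hb hab
        exact hwu (row_inj ha hb hab).1

lemma distinguish_eq_zero_iff {s : Memory} (hs : Env H r n s) (hd : Describes H r n rep s)
    (hsu : s 12 0 = u) (hsv : s 13 0 = v) (hu : u < n) (hv : v < n) :
    distinguish.den s 10 0 = 0 ↔
      ∀ w < n, rep w = w → w ≠ u → w ≠ v → (H.Adj u w ↔ H.Adj v w) := by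
  rw [← not_iff_not, ← ne_eq, distinguish_den, hs.size]
  push Not
  have key : ∀ w, distinguishE.eval (s.write 14 0 w) = 0 ↔ (w < n ∧ rep w = w) ∧ w ≠ u ∧ w ≠ v ∧
      ((H.Adj u w ∧ ¬ H.Adj v w) ∨ (¬ H.Adj u w ∧ H.Adj v w)) := by
    intro w
    rw [← card_block_ne_zero hd.isRep, ← hd.size]
    by_cases hw : w < n
    · have a1 := hs.adj u hu w hw
      have a2 := hs.adj v hv w hw
      have b1 := hs.adj_le (u * n + w)
      have b2 := hs.adj_le (v * n + w)
      rw [← a1, ← a2]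
      simp only [distinguishE, Exp.eval, Memory.write_apply, Nat.reduceEqDiff, false_and, if_false,
        true_and, if_true, hsu, hsv, hs.mul_n u hu.le, hs.mul_n v hv.le]
      omega
    -- The loop also visits `w = n`, which is no vertex; its block size `0` fails the first test.
    · have h0 : s 7 w = 0 := by
        by_contra h0
        rw [hd.size] at h0
        exact hw ((card_block_ne_zero hd.isRep).1 h0).1
      simp only [distinguishE, Exp.eval, Memory.write_apply, Nat.reduceEqDiff, false_and, if_false,
        true_and, if_true, h0]
      omega
  simp only [key]
  constructor
  · rintro ⟨w, -, ⟨hw, hw'⟩, h⟩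
    exact ⟨w, hw, hw', h⟩
  · rintro ⟨w, hw, hw', h⟩
    exact ⟨w, hw.le, ⟨hw, hw'⟩, h⟩

/-! ### Passes of merging -/

lemma tryMerge_den {s : Memory} (hs : Env H r n s) (hd : Describes H r n rep s)
    (hsu : s 12 0 = u) (hsv : s 13 0 = v) :
    ∃ rep', Describes H r n rep' (tryMerge.den s) ∧
      ((reps n rep').card < (reps n rep).card ∨ rep' = rep ∧ ¬ Mergeable H n rep u v) := by
  obtain ⟨s1, hs1⟩ : ∃ s1, s1 = distinguish.den s := ⟨_, rfl⟩
  have k1 : ∀ y, y ∉ distinguish.writes → s1 y = s y := fun y hy => by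
    rw [hs1, den_of_notMem _ _ hy]
  have e1 : Env H r n s1 := hs.congr fun y hy => k1 y (by revert y; decide)
  have d1 : Describes H r n rep s1 := hd.congr (k1 _ (by decide)) (k1 _ (by decide))
  have h12 : s1 12 0 = u := by rw [k1 _ (by decide), hsu]
  have h13 : s1 13 0 = v := by rw [k1 _ (by decide), hsv]
  -- The flag in bank `10` is meaningful only for `u, v < n`; the tests for nonzero block sizes
  -- ensure this.
  have hiff : mergeableE.eval s1 = 0 ↔ Mergeable H n rep u v := by
    have h1 : mergeableE.eval s1 = 0 ↔ u < v ∧ s1 7 u ≠ 0 ∧ s1 7 v ≠ 0 ∧ s1 10 0 = 0 := by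
      simp only [mergeableE, Exp.eval, h12, h13]
      omega
    rw [h1, d1.size, d1.size, card_block_ne_zero hd.isRep, card_block_ne_zero hd.isRep, Mergeable]
    constructor
    · rintro ⟨huv, ⟨hu, hu'⟩, ⟨hv, hv'⟩, h⟩
      rw [hs1, distinguish_eq_zero_iff hs hd hsu hsv hu hv] at h
      exact ⟨huv, hv, hu', hv', h⟩
    · rintro ⟨huv, hv, hu', hv', h⟩
      rw [← distinguish_eq_zero_iff hs hd hsu hsv (huv.trans hv) hv, ← hs1] at h
      exact ⟨huv, ⟨huv.trans hv, hu'⟩, ⟨hv, hv'⟩, h⟩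
  rw [tryMerge, den, ← hs1, den]
  split_ifs with h
  · rw [hiff] at h
    exact ⟨_, merge_den e1 d1 h12 h13 h, Or.inl (card_reps_mergeRep_lt h)⟩
  · rw [hiff] at h
    exact ⟨rep, d1, Or.inr ⟨rfl, h⟩⟩

/-- If the number of blocks has not dropped, no merge took place, so all failed attempts refer to
the same partition and none of its pairs tried so far is mergeable. -/
lemma for_tryMerge_den {s : Memory} (hs : Env H r n s) (hd : Describes H r n rep s)
    (hsu : s 12 0 = u) :
    ∃ rep', Describes H r n rep' ((LoopProg.forLoop 13 tryMerge).den s) ∧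
      ((reps n rep').card < (reps n rep).card ∨
        rep' = rep ∧ ∀ v ≤ n, ¬ Mergeable H n rep u v) := by
  have := for_induction (P := tryMerge) (x := 13) (by decide) (by decide)
    (fun i s' => Env H r n s' ∧ s' 12 0 = u ∧ ∃ rep', Describes H r n rep' s' ∧
      ((reps n rep').card < (reps n rep).card ∨
        rep' = rep ∧ ∀ v < i, ¬ Mergeable H n rep u v)) s
    ⟨hs.congr fun y hy => Memory.write_of_ne _ _ _ (by revert y; decide),
      by rw [Memory.write_of_ne _ _ _ (by decide), hsu], rep,
      hd.congr (Memory.write_of_ne _ _ _ (by decide)) (Memory.write_of_ne _ _ _ (by decide)),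
      Or.inr ⟨rfl, by simp⟩⟩ (by
    rintro i s' ⟨he, hu, rep', hd', hc⟩ hi _ _
    have hk : ∀ y, y ∉ tryMerge.writes → y ≠ 13 →
        (tryMerge.den s').write 13 0 (i + 1) y = s' y := fun y hy hy' => by
      rw [Memory.write_of_ne _ _ _ hy', den_of_notMem _ _ hy]
    obtain ⟨rep'', hd'', hc''⟩ := tryMerge_den he hd' hu hi
    refine ⟨he.congr fun y hy => hk y (by revert y; decide) (by revert y; decide),
      by rw [hk _ (by decide) (by decide), hu], rep'',
      hd''.congr (Memory.write_of_ne _ _ _ (by decide)) (Memory.write_of_ne _ _ _ (by decide)), ?_⟩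
    rcases hc'' with hc'' | ⟨rfl, hm⟩
    · rcases hc with hc | ⟨rfl, -⟩
      · exact Or.inl (hc''.trans hc)
      · exact Or.inl hc''
    · rcases hc with hc | ⟨rfl, hc⟩
      · exact Or.inl hc
      · refine Or.inr ⟨rfl, fun v hv => ?_⟩
        rcases Nat.lt_succ_iff_lt_or_eq.1 hv with hv | rfl
        · exact hc v hv
        · exact hm)
  obtain ⟨-, -, rep', hd', hc⟩ := this
  refine ⟨rep', hd', hc.imp_right fun h => ⟨h.1, fun v hv => h.2 v ?_⟩⟩
  rw [hs.size]
  omega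

lemma for_for_tryMerge_den {s : Memory} (hs : Env H r n s) (hd : Describes H r n rep s) :
    ∃ rep', Describes H r n rep' ((LoopProg.forLoop 12 (.forLoop 13 tryMerge)).den s) ∧
      ((reps n rep').card < (reps n rep).card ∨
        rep' = rep ∧ ∀ u ≤ n, ∀ v ≤ n, ¬ Mergeable H n rep u v) := by
  have := for_induction (P := .forLoop 13 tryMerge) (x := 12) (by decide) (by decide)
    (fun i s' => Env H r n s' ∧ ∃ rep', Describes H r n rep' s' ∧
      ((reps n rep').card < (reps n rep).card ∨
        rep' = rep ∧ ∀ u < i, ∀ v ≤ n, ¬ Mergeable H n rep u v)) s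
    ⟨hs.congr fun y hy => Memory.write_of_ne _ _ _ (by revert y; decide), rep,
      hd.congr (Memory.write_of_ne _ _ _ (by decide)) (Memory.write_of_ne _ _ _ (by decide)),
      Or.inr ⟨rfl, by simp⟩⟩ (by
    rintro i s' ⟨he, rep', hd', hc⟩ hi _ _
    have hk : ∀ y, y ∉ (LoopProg.forLoop 13 tryMerge).writes → y ≠ 12 →
        ((LoopProg.forLoop 13 tryMerge).den s').write 12 0 (i + 1) y = s' y := fun y hy hy' => by
      rw [Memory.write_of_ne _ _ _ hy', den_of_notMem _ _ hy]
    obtain ⟨rep'', hd'', hc''⟩ := for_tryMerge_den he hd' hi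
    refine ⟨he.congr fun y hy => hk y (by revert y; decide) (by revert y; decide), rep'',
      hd''.congr (Memory.write_of_ne _ _ _ (by decide)) (Memory.write_of_ne _ _ _ (by decide)), ?_⟩
    rcases hc'' with hc'' | ⟨rfl, hm⟩
    · rcases hc with hc | ⟨rfl, -⟩
      · exact Or.inl (hc''.trans hc)
      · exact Or.inl hc''
    · rcases hc with hc | ⟨rfl, hc⟩
      · exact Or.inl hc
      · refine Or.inr ⟨rfl, fun u hu => ?_⟩
        rcases Nat.lt_succ_iff_lt_or_eq.1 hu with hu | rfl
        · exact hc u hu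
        · exact hm)
  obtain ⟨-, rep', hd', hc⟩ := this
  refine ⟨rep', hd', hc.imp_right fun h => ⟨h.1, fun u hu => h.2 u ?_⟩⟩
  rw [hs.size]
  omega

/-- A pass without a merge means that no mergeable pair exists, hence at most one block is left.
Otherwise each pass lowers the number of blocks, which starts at no more than `n`, and there are `n
+ 1` passes. -/
lemma mergeAll_den {s : Memory} (hH : H.PathFourFree) (hs : Env H r n s)
    (hd : Describes H r n rep s) :
    ∃ rep', Describes H r n rep' (mergeAll.den s) ∧ (reps n rep').card ≤ 1 := by
  have := for_induction (P := .forLoop 12 (.forLoop 13 tryMerge)) (x := 11) (by decide) (by decide)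
    (fun i s' => Env H r n s' ∧ ∃ rep', Describes H r n rep' s' ∧
      ((reps n rep').card ≤ 1 ∨ (reps n rep').card + i ≤ n)) s
    ⟨hs.congr fun y hy => Memory.write_of_ne _ _ _ (by revert y; decide), rep,
      hd.congr (Memory.write_of_ne _ _ _ (by decide)) (Memory.write_of_ne _ _ _ (by decide)),
      Or.inr (by
        simpa [reps] using Finset.card_filter_le (Finset.range n) (fun x => rep x = x))⟩ (by
    rintro i s' ⟨he, rep', hd', hc⟩ hi _ _
    have hk : ∀ y, y ∉ (LoopProg.forLoop 12 (.forLoop 13 tryMerge)).writes → y ≠ 11 →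
        ((LoopProg.forLoop 12 (.forLoop 13 tryMerge)).den s').write 11 0 (i + 1) y = s' y :=
      fun y hy hy' => by rw [Memory.write_of_ne _ _ _ hy', den_of_notMem _ _ hy]
    obtain ⟨rep'', hd'', hc''⟩ := for_for_tryMerge_den he hd'
    refine ⟨he.congr fun y hy => hk y (by revert y; decide) (by revert y; decide), rep'',
      hd''.congr (Memory.write_of_ne _ _ _ (by decide)) (Memory.write_of_ne _ _ _ (by decide)), ?_⟩
    rcases hc'' with hc'' | ⟨rfl, hm⟩
    · omega
    · refine Or.inl (by_contra fun hlt => ?_)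
      obtain ⟨u, v, huv⟩ := exists_mergeable hH (Nat.lt_of_not_le hlt)
      exact hm u (huv.1.trans huv.2.1).le v huv.2.1.le huv)
  obtain ⟨-, rep', hd', hc⟩ := this
  rw [hs.size] at hc
  exact ⟨rep', hd', by omega⟩

/-! ### Initialisation and reading off the answer -/

lemma tables_den {s : Memory} (hsize : s 1 0 = n)
    (hadj : ∀ u < n, ∀ v < n, (s 2 (u * n + v) ≠ 0 ↔ H.Adj u v)) (hle : ∀ k, s 2 k ≤ 1)
    (h4 : s 4 0 = 0) (h5 : s 5 0 = 0) (h6 : s 6 0 = 0) : Env H (s 0 0) n (tables.den s) := by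
  have := for_induction (P := (.seq (.assign 4 (.add (var 21) (.lit 1))
    (.add (.read 4 (var 21)) (var 1)))
    (.seq (.assign 5 (.add (var 21) (.lit 1)) (.add (.read 5 (var 21)) (.add (var 1) (.lit 1))))
      (.assign 6 (.add (var 21) (.lit 1)) (.add (.read 6 (var 21)) (var 0)))))) (x := 21)
    (by decide) (by decide)
    -- Each multiple comes from the previous one by an addition, starting from cells `0` that are
    -- zero in the input. Round `n` fills the surplus cell `n + 1`.
    (fun i s' => s' 0 0 = s 0 0 ∧ ∀ u ≤ i, s' 4 u = u * n ∧ s' 5 u = u * (n + 1) ∧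
      s' 6 u = u * s 0 0) s
    (by simp [Memory.write_of_ne, h4, h5, h6]) (by
      rintro i s' ⟨h0, hI⟩ hi hin h1
      rw [hsize] at h1
      refine ⟨by simp [den, Memory.write_of_ne, h0], fun u hu => ?_⟩
      obtain ⟨i4, i5, i6⟩ := hI i le_rfl
      simp only [den, Exp.eval, Memory.write_apply, Nat.reduceEqDiff, false_and, if_false,
        true_and, hi, h0, h1, i4, i5, i6, OfNat.zero_ne_ofNat, OfNat.one_ne_ofNat]
      by_cases hui : u = i + 1
      · simp only [hui, if_true]
        refine ⟨by ring, by ring, by ring⟩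
      · simp only [hui, if_false]
        exact hI u (by omega))
  rw [hsize] at this
  have hk : ∀ y, y ∉ tables.writes → tables.den s y = s y := fun y hy => den_of_notMem _ _ hy
  refine ⟨by rw [hk _ (by decide), hsize], by rwa [hk _ (by decide)], by rwa [hk _ (by decide)],
    fun u hu => (this.2 u (by omega)).1, fun u hu => (this.2 u (by omega)).2.1,
    fun u hu => (this.2 u (by omega)).2.2⟩

/-- A single vertex can be a centre or unused, always with no leaves: the entries for `0` and `1`
centres are `1`, the others `0`. The guard skips the surplus round `n`. -/
lemma singletons_den {s : Memory} (hs : Env H r n s) (h7 : ∀ k, s 7 k = 0) (h8 : ∀ k, s 8 k = 0) :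
    Describes H r n id (singletons.den s) := by
  have := for_induction (P := (.ifZero (leE (.add (var 21) (.lit 1)) (var 1))
    (.seq (.assign 7 (var 21) (.lit 1))
      (.seq (.assign 8 (.read 5 (var 21)) (.lit 1))
        (.assign 8 (.add (.read 5 (var 21)) (.lit 1)) (.lit 1)))))) (x := 21)
    (by decide) (by decide)
    (fun i s' => s' 5 = s 5 ∧ (∀ u, s' 7 u = if u < i ∧ u < n then 1 else 0) ∧
      ∀ u < n, ∀ a ≤ n, s' 8 (u * (n + 1) + a) = if u < i ∧ a ≤ 1 then 1 else 0) s
    (by simp [Memory.write_of_ne, h7, h8]) (by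
      rintro i s' ⟨h5, hI, hJ⟩ hi hin h1
      rw [hs.size] at h1 hin
      rw [den]
      simp only [Exp.eval, hi, h1]
      split_ifs with hlt
      · have h5i := hs.mul_succ i hin
        refine ⟨by simp [den, Memory.write_of_ne, h5], fun u => ?_, fun u hu a ha => ?_⟩
        · simp only [den, Exp.eval, Memory.write_apply, Nat.reduceEqDiff, false_and, if_false,
            true_and, hi, hI]
          split_ifs <;> omega
        · simp only [den, Exp.eval, Memory.write_apply, Nat.reduceEqDiff, false_and, if_false,
            true_and, hi, h5, h5i, hJ u hu a ha]
          by_cases hui : u = i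
          · subst hui
            split_ifs <;> omega
          · have ha0 : u * (n + 1) + a ≠ i * (n + 1) := fun h =>
              hui (row_inj (b := 0) ha (by omega) h).1
            have ha1 : u * (n + 1) + a ≠ i * (n + 1) + 1 := fun h =>
              hui (row_inj (b := 1) ha (by omega) h).1
            split_ifs <;> omega
      · refine ⟨by simp [Memory.write_of_ne, h5], fun u => ?_, fun u hu a ha => ?_⟩
        · rw [Memory.write_of_ne _ _ _ (by decide), hI]
          split_ifs <;> omega
        · rw [Memory.write_of_ne _ _ _ (by decide), hJ u hu a ha]
          split_ifs <;> omega)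
  rw [hs.size] at this
  obtain ⟨-, hI, hJ⟩ := this
  have hb : ∀ u < n, block n id u = {u} := by
    intro u hu
    ext x
    simp only [mem_block, id, Finset.mem_singleton]
    constructor
    · exact fun h => h.2
    · rintro rfl
      exact ⟨hu, rfl⟩
  refine ⟨isRep_id, fun u => ?_, fun u hu _ a ha e => ?_⟩
  · rw [singletons, hI]
    by_cases hu : u < n
    · rw [hb u hu, if_pos ⟨by omega, hu⟩, Finset.card_singleton]
    · rw [if_neg (by omega), eq_comm, Finset.card_eq_zero, Finset.eq_empty_iff_forall_notMem]
      intro x hx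
      obtain ⟨hxn, rfl⟩ := mem_block.1 hx
      exact hu hxn
  · rw [singletons, hJ u hu a ha, hb u hu, SimpleGraph.starFeasible_singleton]
    split_ifs <;> omega

/-- The row of block `0` starts at cell `0`, so `s 6 k < s 8 k` compares `k * r` with the entry for
`k` centres. As `k` increases, the last success is the largest. -/
lemma answer_den {s : Memory} (h3 : s 3 0 = 0) :
    (answer.den s 3 0 = 0 ∨
      answer.den s 3 0 ≤ s 1 0 ∧ s 6 (answer.den s 3 0) < s 8 (answer.den s 3 0)) ∧
    ∀ k ≤ s 1 0, s 6 k < s 8 k → k ≤ answer.den s 3 0 := by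
  have := for_induction
    (P := .ifZero (leE (.add (.read 6 (var 22)) (.lit 1)) (.read 8 (var 22)))
      (.assign 3 (.lit 0) (var 22))) (x := 22) (by decide) (by decide)
    (fun i s' => s' 6 = s 6 ∧ s' 8 = s 8 ∧ (s' 3 0 = 0 ∨ s' 3 0 < i ∧ s 6 (s' 3 0) < s 8 (s' 3 0)) ∧
      (∀ k < i, s 6 k < s 8 k → k ≤ s' 3 0) ∧ s' 3 0 ≤ i) s
    (by simp [Memory.write_of_ne, h3]) (by
      rintro i s' ⟨h6, h8, hI, hJ, hle⟩ hi hin _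
      rw [den]
      simp only [Exp.eval, hi, h6, h8]
      split_ifs with h
      · refine ⟨by simp [den, Memory.write_of_ne, h6], by simp [den, Memory.write_of_ne, h8], ?_⟩
        simp only [den, Exp.eval, hi, Memory.write_apply, Nat.reduceEqDiff, false_and, if_false,
          true_and, if_true]
        exact ⟨Or.inr (by omega), fun k hk _ => by omega, by omega⟩
      · refine ⟨by simp [Memory.write_of_ne, h6], by simp [Memory.write_of_ne, h8], ?_⟩
        rw [Memory.write_of_ne _ _ _ (by decide)]
        refine ⟨by omega, fun k hk hk' => ?_, by omega⟩
        rcases Nat.lt_succ_iff_lt_or_eq.1 hk with hk | rfl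
        · exact hJ k hk hk'
        · omega)
  obtain ⟨-, -, hI, hJ, -⟩ := this
  rw [answer]
  exact ⟨hI.imp_right fun h => ⟨by omega, h.2⟩, fun k hk => hJ k (by omega)⟩

/-! ### Correctness of the whole program -/

open Classical in
theorem starPacking_den {G : SimpleGraph (Fin n)} (hG : NoInducedPath 4 G) :
    IsGreatest {k : ℕ | HasDisjointCopies (starK r) G k}
      (output (starPacking.den (inputMemory r G))) := by
  obtain ⟨s, hs⟩ : ∃ s, s = inputMemory r G := ⟨_, rfl⟩
  have i0 : s 0 0 = r := by rw [hs]; rfl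
  have i1 : s 1 0 = n := by rw [hs]; rfl
  have i3 : s 3 0 = 0 := by rw [hs]; rfl
  have i4 : s 4 0 = 0 := by rw [hs]; rfl
  have i5 : s 5 0 = 0 := by rw [hs]; rfl
  have i6 : s 6 0 = 0 := by rw [hs]; rfl
  have i7 : ∀ k, s 7 k = 0 := fun k => by rw [hs]; rfl
  have i8 : ∀ k, s 8 k = 0 := fun k => by rw [hs]; rfl
  have i2 : ∀ k, s 2 k = if ∃ i j : Fin n, G.Adj i j ∧ k = n * (i : ℕ) + (j : ℕ) then 1 else 0 :=
    fun k => by rw [hs]; rfl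
  obtain ⟨s1, hs1⟩ : ∃ s1, s1 = tables.den s := ⟨_, rfl⟩
  obtain ⟨s2, hs2⟩ : ∃ s2, s2 = singletons.den s1 := ⟨_, rfl⟩
  obtain ⟨s3, hs3⟩ : ∃ s3, s3 = mergeAll.den s2 := ⟨_, rfl⟩
  have k1 : ∀ y, y ∉ tables.writes → s1 y = s y := fun y hy => by rw [hs1, den_of_notMem _ _ hy]
  have k2 : ∀ y, y ∉ singletons.writes → s2 y = s1 y := fun y hy => by
    rw [hs2, den_of_notMem _ _ hy]
  have k3 : ∀ y, y ∉ mergeAll.writes → s3 y = s2 y := fun y hy => by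
    rw [hs3, den_of_notMem _ _ hy]
  have e1 : Env G.onNat r n s1 := by
    rw [hs1, ← i0]
    refine tables_den i1 (fun u hu v hv => ?_) (fun k => ?_) i4 i5 i6
    · rw [i2]
      simp only [ne_eq, ite_eq_right_iff, one_ne_zero, imp_false, not_not]
      constructor
      · rintro ⟨i, j, hij, h⟩
        have hn : 0 < n := by omega
        rw [mul_comm u n] at h
        have hu' : u = i := by
          have := congrArg (· / n) h
          simpa [Nat.mul_add_div hn, Nat.div_eq_of_lt hv, Nat.div_eq_of_lt j.2] using this
        subst hu'
        obtain rfl : v = j := by omega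
        exact ⟨i.2, j.2, hij⟩
      · rintro ⟨_, _, h⟩
        exact ⟨_, _, h, by rw [mul_comm]⟩
    · rw [i2]
      split_ifs <;> omega
  have e2 : Env G.onNat r n s2 := e1.congr fun y hy => k2 y (by revert y; decide)
  have e3 : Env G.onNat r n s3 := e2.congr fun y hy => k3 y (by revert y; decide)
  have d2 : Describes G.onNat r n id s2 := by
    rw [hs2]
    refine singletons_den e1 ?_ ?_
    · rw [k1 _ (by decide)]; exact i7
    · rw [k1 _ (by decide)]; exact i8
  obtain ⟨rep, d3, hrep⟩ :=
    mergeAll_den (SimpleGraph.PathFourFree.of_noInducedPath hG).onNat e2 d2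
  rw [← hs3] at d3
  have hblock : block n rep 0 = Finset.range n := by
    ext x
    rw [mem_block, Finset.mem_range]
    exact ⟨fun h => h.1, fun h => ⟨h, rep_eq_zero d3.isRep hrep h⟩⟩
  -- For `n = 0` there is no block and no table row to rely on; there the bound `k ≤ n` alone
  -- settles the answer `0`.
  have hgood : 0 < n → ∀ k ≤ n, s3 6 k < s3 8 k ↔ HasDisjointCopies (starK r) G k := by
    intro hn k hk
    have := d3.table 0 hn (rep_eq_zero d3.isRep hrep hn) k hk (k * r)
    rw [zero_mul, zero_add, hblock] at this
    rw [e3.mul_r k hk, this]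
    exact ⟨fun h => h.hasDisjointCopies, fun h => .of_hasDisjointCopies h⟩
  have hbound : ∀ k, HasDisjointCopies (starK r) G k → k ≤ n := by
    intro k hk
    have := (SimpleGraph.StarFeasible.of_hasDisjointCopies hk).add_le
    rw [Finset.card_range] at this
    omega
  have hzero : HasDisjointCopies (starK r) G 0 := ⟨fun i => i.elim0, fun i => i.elim0⟩
  obtain ⟨ha, hb⟩ := answer_den (s := s3)
    (by rw [k3 _ (by decide), k2 _ (by decide), k1 _ (by decide), i3])
  rw [e3.size] at ha hb
  have hden : starPacking.den s = answer.den s3 := by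
    rw [starPacking, den, den, den, ← hs1, ← hs2, ← hs3]
  rw [← hs, output, hden]
  constructor
  · rcases ha with ha | ⟨ha, ha'⟩
    · rw [ha]
      exact hzero
    · rcases Nat.eq_zero_or_pos n with hn | hn
      · rw [Nat.le_zero.1 (ha.trans_eq hn)]
        exact hzero
      · exact (hgood hn _ ha).1 ha'
  · intro k hk
    have hkn := hbound k hk
    rcases Nat.eq_zero_or_pos n with hn | hn
    · omega
    · exact hb k hkn ((hgood hn k hkn).2 hk)

end LoopProg

end RAM

theorem theorem3 :
    ∃ (P : RAM.Prog) (p : Polynomial ℕ),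
      ∀ r : ℕ, 3 ≤ r → ∀ (n : ℕ) (G : SimpleGraph (Fin n)), NoInducedPath 4 G →
        ∃ (s : RAM.Memory) (t : ℕ),
          RAM.Exec P (RAM.inputMemory r G) s t ∧ t ≤ p.eval n ∧
          IsGreatest {k : ℕ | HasDisjointCopies (starK r) G k} (RAM.output s) := by
  refine ⟨RAM.LoopProg.starPacking.compile, RAM.LoopProg.starPacking.time, ?_⟩
  intro r _ n G hG
  obtain ⟨t, ht, hle⟩ := RAM.LoopProg.starPacking.exec_compile
    (by simp [RAM.LoopProg.LoopsFixed, RAM.LoopProg.starPacking, RAM.LoopProg.tables,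
      RAM.LoopProg.singletons, RAM.LoopProg.mergeAll, RAM.LoopProg.tryMerge,
      RAM.LoopProg.distinguish, RAM.LoopProg.merge, RAM.LoopProg.clear, RAM.LoopProg.combine,
      RAM.LoopProg.combineStep, RAM.LoopProg.copyRow, RAM.LoopProg.answer, RAM.LoopProg.writes])
    (by decide) (RAM.inputMemory r G)
  exact ⟨_, t, ht, hle, RAM.LoopProg.starPacking_den hG⟩
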